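/- Let $R$ be a commutative Noetherian ring, $M$ a finitely generated $R$-module and $I$ an ideal of $R$. For a submodule $N\subseteq M$ let $\mathrm{ir}_M(N)$ be the number of submodules in an irredundant decomposition of $N$ as an intersection of irreducible submodules of $M$, and let $\mathrm{Ir}_{M,I}$ denote the polynomial with rational coefficients such that $\mathrm{Ir}_{M,I}(n)=\mathrm{ir}_M(I^nM)$ for all sufficiently large $n$. Let $$\mathrm{bight}_M(I)=\max\{\dim_{R_{\mathfrak p}}M_{\mathfrak p}\mid \mathfrak p \text{ minimal in } \mathrm{Ass}_R(M/IM)\}.$$ Let $A_M(I)$ be the set of primes that lie in $\mathrm{Ass}_R(M/I^nM)$ for all large $n$. Let $G(I)=\bigoplus_{n\ge0}I^n/I^{n+1}$ and $G_M(I)=\bigoplus_{n\ge0}I^nM/I^{n+1}M$. If $R$ is local with maximal ideal $\mathfrak m$, put $\ell_M(I)=\dim_{G(I)}\bigl(G_M(I)/\mathfrak m G_M(I)\bigr)$; if $R$ is not local, let $\ell_M(I)$ be the maximum of $\ell_{M_{\mathfrak m}}(IR_{\mathfrak m})$ over the maximal ideals $\mathfrak m$ of $R$ that contain some $\mathfrak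 p\in A_M(I)$. (1) If $\ell_M(I)=\mathrm{bight}_M(I)$ and this number is at least $1$, then the polynomial $\mathrm{Ir}_{M,I}$ exists, is nonzero, and $$\deg \mathrm{Ir}_{M,I}=\ell_M(I)-1.$$ (2) In particular, if $R$ is local and $I$ is an equimultiple ideal, i.e. $\ell_R(I)=\mathrm{ht}(I)$, with $\mathrm{ht}(I)\ge 1$, then the polynomial $\mathrm{Ir}_{R,I}$ exists, is nonzero, and $$\deg \mathrm{Ir}_{R,I}=\mathrm{ht}(I)-1.$$ -/

import Mathlib

universe u v

set_option maxSynthPendingDepth 3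

namespace IrPoly

section Reducibility

variable {R : Type*} [CommRing R] {M : Type*} [AddCommGroup M] [Module R M]

/-- `s` is an irredundant irreducible decomposition of the submodule `N`: its members are
irreducible submodules (proper, and not an intersection of two strictly larger submodules),
they intersect in `N`, and none of them can be left out. -/
def IsIrredundantDecomposition (N : Submodule R M) (s : Finset (Submodule R M)) : Prop :=
  (∀ Q ∈ s, InfIrred Q) ∧ s.inf id = N ∧ ∀ t : Finset (Submodule R M), t ⊂ s → t.inf id ≠ N

/-- The index of reducibility `ir_M(N)`: the number of members of an irredundant irreducible
decomposition of `N`. For a Noetherian module such decompositions exist and they all have the same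
number of members, so the infimum below is that common number. -/
noncomputable def ir (N : Submodule R M) : ℕ :=
  sInf {k : ℕ | ∃ s : Finset (Submodule R M), IsIrredundantDecomposition N s ∧ s.card = k}

/-- The infimum defining `ir N` is over a nonempty set. -/
theorem exists_isIrredundantDecomposition [IsNoetherian R M] (N : Submodule R M) :
    ∃ s : Finset (Submodule R M), IsIrredundantDecomposition N s := by
  obtain ⟨s₀, h₀, h₁⟩ := exists_infIrred_decomposition N
  obtain ⟨s, ⟨hs, hN⟩, hmin⟩ := WellFounded.has_min (wellFounded_lt (α := Finset (Submodule R M)))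
    {s | (∀ Q ∈ s, InfIrred Q) ∧ s.inf id = N} ⟨s₀, fun Q hQ => h₁ hQ, h₀⟩
  exact ⟨s, hs, hN, fun t ht h => hmin t ⟨fun Q hQ => hs Q (ht.1 hQ), h⟩ ht⟩

variable (R M) in
/-- `P` is the polynomial `Ir_{M,I}`: `P(n) = ir_M(Iⁿ M)` for all large `n`. There is at most one
such `P`. -/
def IsIrPolynomial (I : Ideal R) (P : Polynomial ℚ) : Prop :=
  ∀ᶠ n : ℕ in Filter.atTop,
    (ir (I ^ n • (⊤ : Submodule R M)) : ℚ) = P.eval (n : ℚ)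

end Reducibility

section BigHeight

variable (R : Type*) [CommRing R] (M : Type*) [AddCommGroup M] [Module R M] (I : Ideal R)

/-- The big height of `I` on `M`: the maximum of `dim M_𝔭` over the minimal members `𝔭` of
`Ass (M / I M)` (it is `⊥` if `M = I M`). -/
noncomputable def bight : WithBot ℕ∞ :=
  ⨆ p : {p : PrimeSpectrum R //
      Minimal (fun q : Ideal R => q ∈ associatedPrimes R (M ⧸ (I • (⊤ : Submodule R M))))
        p.asIdeal},
    Module.supportDim (Localization.AtPrime p.1.asIdeal)
      (LocalizedModule.AtPrime p.1.asIdeal M)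

/-- `A_M(I)`, the set of primes associated to `M / Iⁿ M` for all large `n`. For `R` Noetherian and
`M` finitely generated it is the stable value of `Ass (M / Iⁿ M)`. -/
def stableAss : Set (Ideal R) :=
  {p | ∀ᶠ n : ℕ in Filter.atTop,
    p ∈ associatedPrimes R (M ⧸ (I ^ n • (⊤ : Submodule R M)))}

end BigHeight

section AnalyticSpread

variable (R : Type*) [CommRing R] (M : Type*) [AddCommGroup M] [Module R M] (I : Ideal R)

/-- The Rees module `⨁ₙ Iⁿ M tⁿ ⊆ M[t]`, a module over the Rees algebra `⨁ₙ Iⁿ tⁿ ⊆ R[t]`. -/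
abbrev ReesModule : Type _ := (I.stableFiltration (⊤ : Submodule R M)).submodule

/-- The extension of `I` to the Rees algebra, `⨁ₙ Iⁿ⁺¹ tⁿ`. -/
noncomputable def reesExt : Ideal (reesAlgebra I) := I.map (algebraMap R (reesAlgebra I))

/-- The associated graded ring `G(I) = ⨁ₙ Iⁿ / Iⁿ⁺¹`, the Rees algebra modulo the
extension of `I`. -/
def GrRing : Type _ := reesAlgebra I ⧸ reesExt R I

noncomputable instance : CommRing (GrRing R I) :=
  inferInstanceAs (CommRing (reesAlgebra I ⧸ reesExt R I))

noncomputable instance : Algebra R (GrRing R I) :=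
  inferInstanceAs (Algebra R (reesAlgebra I ⧸ reesExt R I))

/-- The associated graded module `G_M(I) = ⨁ₙ Iⁿ M / Iⁿ⁺¹ M` over `G(I)`, the Rees module modulo
`I` times it. -/
def GrModule : Type _ :=
  ReesModule R M I ⧸ (reesExt R I • (⊤ : Submodule (reesAlgebra I) (ReesModule R M I)))

noncomputable instance : AddCommGroup (GrModule R M I) :=
  inferInstanceAs (AddCommGroup
    (ReesModule R M I ⧸ (reesExt R I • (⊤ : Submodule (reesAlgebra I) (ReesModule R M I)))))

noncomputable instance : Module (GrRing R I) (GrModule R M I) :=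
  inferInstanceAs (Module (reesAlgebra I ⧸ reesExt R I)
    (ReesModule R M I ⧸ (reesExt R I • (⊤ : Submodule (reesAlgebra I) (ReesModule R M I)))))

/-- The analytic spread over a local ring: `dim_{G(I)} (G_M(I) / 𝔪 G_M(I))`. -/
noncomputable def localAnalyticSpread [IsLocalRing R] : WithBot ℕ∞ :=
  Module.supportDim (GrRing R I)
    (GrModule R M I ⧸
      ((IsLocalRing.maximalIdeal R).map (algebraMap R (GrRing R I)) •
        (⊤ : Submodule (GrRing R I) (GrModule R M I))))

open Classical in
/-- The analytic spread `ℓ_M(I)`. If `R` is not local it is the maximum of the local analytic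
spreads of `I R_𝔪` on `M_𝔪` over the maximal ideals `𝔪` that contain some `𝔭 ∈ A_M(I)`. -/
noncomputable def analyticSpread : WithBot ℕ∞ :=
  if _h : IsLocalRing R then localAnalyticSpread R M I
  else
    ⨆ m : {m : MaximalSpectrum R // ∃ p ∈ stableAss R M I, p ≤ m.asIdeal},
      localAnalyticSpread (Localization.AtPrime m.1.asIdeal)
        (LocalizedModule.AtPrime m.1.asIdeal M)
        (I.map (algebraMap R (Localization.AtPrime m.1.asIdeal)))

/-- An ideal `I` of a local ring is equimultiple if `ℓ(I) = ht(I)`. -/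
def IsEquimultiple [IsLocalRing R] : Prop :=
  analyticSpread R R I = (I.height : WithBot ℕ∞)

end AnalyticSpread

end IrPoly

/-! The index of reducibility is a sum of local invariants: `ir N` is the sum, over the primes `p`
associated to `M / N`, of the length of the socle of `(M / N)_p` (`ir_eq_sum`). The primes
associated to the modules `M / Iⁿ M`, for all `n` together, form a finite set
(`exists_finset_associatedPrimes`), so only finitely many functions of `n` matter. Each is
eventually polynomial (`exists_soclePolynomial`): by Artin–Rees the submodules `(Iⁿ M : 𝔪)` are
eventually `I`-adic up to the fixed submodule `(0 : 𝔪)`, and a Hilbert function argument applies.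

Upper bound. If the analytic spread is at most `d`, homogeneous parameters of the fibre cone give an
ideal `J` generated by `d` elements of some `Iᵉ` with `Iⁿ⁺ᵉ M = J Iⁿ M` for some `n`
(`exists_reduction`). The filtration by powers of `Iᵉ` is then eventually `J`-adic, so the socle
polynomials have degree less than `d` (`degree_soclePolynomial_lt`). A reduction found at a maximal
ideal localizes to all primes below it, which covers every prime that contributes.

Lower bound. If `p` is minimal in `Ass (M / I M)`, then `I M_p` contains some `(p R_p)ˢ M_p`, so the
length of `Iⁿ M_p / Iⁿ⁺¹ M_p` is at most a constant times the socle length of `M_p / Iⁿ⁺¹ M_p`.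
Socle growth of degree less than `d - 1` would give a Hilbert–Samuel function of degree at most `d -
1`, hence `dim M_p ≤ d - 1` (`supportDim_le_of_polyBounded_socleLen`). Socle lengths are
nonnegative, so the summands cannot cancel, and the degree is exactly `d - 1` once `dim M_p ≥ d`
(`exists_isIrPolynomial_of_le_supportDim`). -/

namespace IrPoly

/-! ### Lengths of subquotients. -/

section RelLen

variable {R : Type*} [CommRing R] {N : Type*} [AddCommGroup N] [Module R N]
  {N' : Type*} [AddCommGroup N'] [Module R N']

/-- The length of `(U + L) / L` for submodules `L`, `U`. -/
noncomputable def relLen (L U : Submodule R N) : ℕ∞ := Module.length R (U.map L.mkQ)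

/-- The map `N / f⁻¹ L → N' / L` induced by `f` is injective, so it preserves the length of the
image of `U`. Lengths are carried along linear maps by this identity. -/
theorem relLen_comap (f : N →ₗ[R] N') (L : Submodule R N') (U : Submodule R N) :
    relLen (L.comap f) U = relLen L (U.map f) := by
  unfold relLen
  let g : (N ⧸ L.comap f) →ₗ[R] N' ⧸ L := (L.comap f).mapQ L f le_rfl
  have hg : Function.Injective g := by
    rw [← LinearMap.ker_eq_bot]
    simp [g, Submodule.mapQ, Submodule.ker_liftQ, LinearMap.ker_comp]
  rw [(Submodule.equivMapOfInjective g hg (U.map (L.comap f).mkQ)).length_eq,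
    ← Submodule.map_comp, ← Submodule.map_comp]
  rfl

theorem relLen_add {L K U : Submodule R N} (h₁ : L ≤ K) (h₂ : K ≤ U) :
    relLen L U = relLen L K + relLen K U := by
  refine Module.length_eq_add_of_exact
    (Submodule.inclusion (Submodule.map_mono h₂ : K.map L.mkQ ≤ U.map L.mkQ))
    ((Submodule.factor h₁).restrict (p := U.map L.mkQ) (q := U.map K.mkQ) ?_)
    (Submodule.inclusion_injective _) ?_ ?_
  · rintro _ ⟨x, hx, rfl⟩
    exact ⟨x, hx, rfl⟩
  · rintro ⟨_, x, hx, rfl⟩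
    exact ⟨⟨L.mkQ x, x, hx, rfl⟩, rfl⟩
  · rintro ⟨_, x, hx, rfl⟩
    constructor
    · intro h
      have hxK : x ∈ K := by
        have := congrArg Subtype.val h
        exact (Submodule.Quotient.mk_eq_zero K).1 this
      exact ⟨⟨L.mkQ x, x, hxK, rfl⟩, rfl⟩
    · rintro ⟨⟨_, y, hy, rfl⟩, h⟩
      have h' : L.mkQ y = L.mkQ x := congrArg Subtype.val h
      ext
      change K.mkQ x = 0
      have hxy : y - x ∈ L := (Submodule.Quotient.eq L).1 h'
      have : x ∈ K := by
        have := K.sub_mem hy (h₁ hxy)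
        simpa using this
      simpa using this

theorem relLen_mono_right (L : Submodule R N) {U U' : Submodule R N} (h : U ≤ U') :
    relLen L U ≤ relLen L U' :=
  Module.length_le_of_injective (Submodule.inclusion (Submodule.map_mono h))
    (Submodule.inclusion_injective _)

theorem relLen_sup_left (L U : Submodule R N) : relLen L (L ⊔ U) = relLen L U := by
  unfold relLen
  rw [Submodule.map_sup, Submodule.mkQ_map_self, bot_sup_eq]

theorem relLen_inf_left (L U : Submodule R N) : relLen (L ⊓ U) U = relLen L U := by
  have h₁ := relLen_comap U.subtype (L ⊓ U) ⊤
  have h₂ := relLen_comap U.subtype L ⊤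
  rw [Submodule.map_top, Submodule.range_subtype] at h₁ h₂
  rw [← h₁, ← h₂]
  congr 1
  ext x
  simp

theorem relLen_anti_left (U : Submodule R N) {L L' : Submodule R N} (h : L ≤ L') :
    relLen L' U ≤ relLen L U := by
  rw [← relLen_inf_left L' U, ← relLen_inf_left L U,
    relLen_add (inf_le_inf_right U h) inf_le_right]
  exact le_add_self

theorem relLen_eq_zero {L U : Submodule R N} : relLen L U = 0 ↔ U ≤ L := by
  unfold relLen
  rw [Module.length_eq_zero_iff, Submodule.subsingleton_iff_eq_bot, ← LinearMap.le_ker_iff_map,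
    Submodule.ker_mkQ]

theorem relLen_le_add (L K U : Submodule R N) : relLen L U ≤ relLen L K + relLen K U := by
  calc relLen L U ≤ relLen L (L ⊔ K ⊔ U) := relLen_mono_right _ le_sup_right
    _ = relLen L (L ⊔ K) + relLen (L ⊔ K) (L ⊔ K ⊔ U) := relLen_add le_sup_left le_sup_left
    _ ≤ _ := by
      rw [relLen_sup_left, relLen_sup_left]
      gcongr
      exact relLen_anti_left _ le_sup_right

theorem relLen_split {L K : Submodule R N} (U : Submodule R N) (h : L ≤ K) :
    relLen L U = relLen L (K ⊓ U) + relLen K U := by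
  rw [← relLen_inf_left L U, relLen_add (inf_le_inf_right U h) inf_le_right, relLen_inf_left K U]
  congr 1
  rw [← relLen_inf_left L (K ⊓ U), ← inf_assoc, inf_eq_left.2 h]

theorem relLen_congr_of_le {L U V : Submodule R N} (h₁ : V ≤ U) (h₂ : U ≤ V ⊔ L) :
    relLen L U = relLen L V := by
  refine le_antisymm ?_ (relLen_mono_right _ h₁)
  rw [← relLen_sup_left L V, sup_comm]
  exact relLen_mono_right _ h₂

end RelLen

/-! ### Antidifferences of polynomials. -/

section Polynomials

open Polynomial

theorem degree_bernoulli_le (n : ℕ) : (Polynomial.bernoulli n).degree ≤ n := by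
  rw [Polynomial.bernoulli]
  refine (degree_sum_le _ _).trans (Finset.sup_le fun i _ => (degree_monomial_le _ _).trans ?_)
  exact_mod_cast Nat.sub_le n i

/-- Bernoulli polynomials satisfy `B_{i+1}(x + 1) - B_{i+1}(x) = (i + 1) xⁱ`, so each monomial has
an antidifference of degree one higher. -/
theorem exists_antidifference (P : ℚ[X]) {r : ℕ} (hP : P.degree < r) :
    ∃ Q : ℚ[X], Q.degree < (r + 1 : ℕ) ∧ ∀ x : ℚ, Q.eval (x + 1) - Q.eval x = P.eval x := by
  refine ⟨∑ i ∈ Finset.range r, C (P.coeff i / (i + 1)) * Polynomial.bernoulli (i + 1), ?_, ?_⟩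
  · refine (degree_sum_le _ _).trans_lt ((Finset.sup_lt_iff ?_).2 fun i hi => ?_)
    · exact WithBot.bot_lt_coe _
    · refine (degree_mul_le _ _).trans_lt ((add_le_add degree_C_le (degree_bernoulli_le _)).trans_lt ?_)
      have := Finset.mem_range.1 hi
      rw [zero_add]
      exact_mod_cast Nat.succ_lt_succ this
  · intro x
    rw [Polynomial.eval_finsetSum, Polynomial.eval_finsetSum, ← Finset.sum_sub_distrib]
    have hP' : P.natDegree < r ∨ P = 0 := by
      by_cases h0 : P = 0
      · exact Or.inr h0
      · exact Or.inl ((natDegree_lt_iff_degree_lt h0).2 hP)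
    have hsum : P.eval x = ∑ i ∈ Finset.range r, P.coeff i * x ^ i := by
      rcases hP' with h | h
      · exact eval_eq_sum_range' h x
      · simp [h]
    rw [hsum]
    refine Finset.sum_congr rfl fun i _ => ?_
    rw [eval_mul, eval_mul, eval_C, eval_C, add_comm x 1, Polynomial.bernoulli_eval_one_add]
    have : (i : ℚ) + 1 ≠ 0 := by positivity
    push_cast
    rw [← mul_sub, add_sub_cancel_left]
    field_simp

theorem eventually_poly_of_difference {f : ℕ → ℚ} {P : ℚ[X]} {r : ℕ} (hP : P.degree < r)
    (h : ∀ᶠ n in Filter.atTop, f (n + 1) - f n = P.eval (n : ℚ)) :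
    ∃ Q : ℚ[X], Q.degree < (r + 1 : ℕ) ∧ ∀ᶠ n : ℕ in Filter.atTop, f n = Q.eval (n : ℚ) := by
  obtain ⟨Q, hQ, hQP⟩ := exists_antidifference P hP
  obtain ⟨c, hc⟩ := Filter.eventually_atTop.1 h
  refine ⟨Q + C (f c - Q.eval (c : ℚ)), ?_, Filter.eventually_atTop.2 ⟨c, fun n hn => ?_⟩⟩
  · refine (degree_add_le _ _).trans_lt (max_lt hQ (degree_C_le.trans_lt ?_))
    exact_mod_cast Nat.succ_pos r
  · induction n, hn using Nat.le_induction with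
    | base => simp
    | succ n hn ih =>
      have h₁ := hc n hn
      have h₂ := hQP n
      simp only [eval_add, eval_C, Nat.cast_add, Nat.cast_one] at ih ⊢
      linarith

end Polynomials

/-! ### Hilbert polynomials of filtrations. -/

section Hilbert

open Polynomial Filter

variable {R : Type*} [CommRing R] [IsNoetherianRing R] {N : Type*} [AddCommGroup N] [Module R N]
  [Module.Finite R N]

/-- Artin–Rees: a `J`-filtration contained in a `J`-adic one is eventually `J`-adic. -/
theorem eventually_smul_eq_of_le {J : Ideal R} {W : Submodule R N} {K : ℕ → Submodule R N}
    (hK : Antitone K) (hJ : ∀ n, J • K n ≤ K (n + 1)) (hW : ∀ n, K n ≤ J ^ n • W) :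
    ∀ᶠ n in atTop, J • K n = K (n + 1) := by
  let F : J.Filtration N := ⟨K, fun n => hK n.le_succ, hJ⟩
  have hF : F.Stable := (J.stableFiltration_stable W).of_le (F' := F) hW
  obtain ⟨n₀, h⟩ := hF
  exact eventually_atTop.2 ⟨n₀, h⟩

set_option maxHeartbeats 1000000 in
/-- Hilbert polynomial: if multiplication by an ideal `J` with `r` generators carries `U n / L n`
to `U (n + 1) / L (n + 1)` and is eventually surjective, then the length of `U n / L n` is
eventually a polynomial of degree less than `r`. -/
theorem exists_hilbertPolynomial : ∀ (r : ℕ) (a : Fin r → R) (U L : ℕ → Submodule R N),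
    Antitone L → (∀ n, Ideal.span (Set.range a) • U n ≤ U (n + 1)) →
    (∀ n, Ideal.span (Set.range a) • L n ≤ L (n + 1)) →
    (∀ᶠ n in atTop, U (n + 1) ≤ Ideal.span (Set.range a) • U n ⊔ L (n + 1)) →
    (∀ n, relLen (L n) (U n) ≠ ⊤) →
    ∃ P : ℚ[X], P.degree < r ∧
      ∀ᶠ n : ℕ in atTop, ((relLen (L n) (U n)).toNat : ℚ) = P.eval (n : ℚ) := by
  intro r
  induction r with
  | zero =>
    intro a U L hL hU hJL hgen hfin
    obtain ⟨c, hc⟩ := eventually_atTop.1 hgen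
    refine ⟨0, by simp, eventually_atTop.2 ⟨c + 1, fun n hn => ?_⟩⟩
    obtain ⟨k, rfl⟩ : ∃ k, n = k + 1 := ⟨n - 1, by lia⟩
    have h := hc k (by lia)
    rw [Set.range_eq_empty, Ideal.span_empty, Submodule.bot_smul, bot_sup_eq] at h
    simp [relLen_eq_zero.2 h]
  | succ r ih =>
    intro a U L hL hU hJL hgen hfin
    set J := Ideal.span (Set.range a) with hJ
    set x := a 0 with hx
    set a' : Fin r → R := fun i => a i.succ with ha'
    set J' := Ideal.span (Set.range a') with hJ'
    have hJsup : J = J' ⊔ Ideal.span {x} := by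
      rw [hJ, hJ', ← Ideal.span_union]
      congr 1
      ext y
      simp only [Set.mem_range, Set.mem_union, Set.mem_singleton_iff, ha', hx, Fin.exists_fin_succ]
      tauto
    have hJ'J : J' ≤ J := hJsup ▸ le_sup_left
    have hxJ : x ∈ J := Ideal.subset_span ⟨0, rfl⟩
    obtain ⟨φ, hφ⟩ : ∃ φ : N →ₗ[R] N, φ = LinearMap.lsmul R N x := ⟨_, rfl⟩
    have hφa : ∀ y, φ y = x • y := fun y => by rw [hφ]; rfl
    have hsmul : ∀ W : Submodule R N, J • W = J' • W ⊔ W.map φ := by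
      intro W
      rw [hJsup, Submodule.sup_smul, Submodule.ideal_span_singleton_smul, hφ]
      rfl
    obtain ⟨c, hc⟩ := eventually_atTop.1 hgen
    -- From the index `c` on, `U` may be replaced by the `J`-adic filtration of `U c`: the two agree
    -- modulo `L`. Being genuinely `J`-adic, `V` is accessible to Artin–Rees.
    obtain ⟨V, hVdef⟩ : ∃ V : ℕ → Submodule R N, ∀ n, V n = J ^ n • U c := ⟨_, fun _ => rfl⟩
    have hV : ∀ n, V (n + 1) = J • V n := fun n => by
      simp only [hVdef, pow_succ', mul_smul]
    have hVanti : Antitone V := antitone_nat_of_succ_le fun n => by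
      rw [hV]; exact Submodule.smul_le_right
    have hVU : ∀ n, V n ≤ U (c + n) := by
      intro n
      induction n with
      | zero => simp [hVdef]
      | succ n ihn =>
        rw [hV]
        exact (Submodule.smul_mono le_rfl ihn).trans (hU (c + n))
    have hUV : ∀ n, U (c + n) ≤ V n ⊔ L (c + n) := by
      intro n
      induction n with
      | zero => simp [hVdef]
      | succ n ihn =>
        refine (hc (c + n) (by lia)).trans (sup_le ?_ le_sup_right)
        refine (Submodule.smul_mono le_rfl ihn).trans ?_
        rw [Submodule.smul_sup, ← hV]
        exact sup_le_sup le_rfl (hJL _)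
    have hlen : ∀ n, relLen (L (c + n)) (U (c + n)) = relLen (L (c + n)) (V n) := fun n =>
      relLen_congr_of_le (hVU n) (hUV n)
    have hLφ : ∀ n, L (c + n) ≤ (L (c + (n + 1))).comap φ := fun n y hy => by
      rw [Submodule.mem_comap, hφa]
      exact hJL _ (Submodule.smul_mem_smul hxJ hy)
    -- `K n` represents the kernel of multiplication by `x` from `V n / L (c + n)` to the next
    -- subquotient. It lies in a `J`-adic filtration, hence is eventually `J`-adic.
    obtain ⟨K, hK⟩ : ∃ K : ℕ → Submodule R N, ∀ n, K n = (L (c + (n + 1))).comap φ ⊓ V n :=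
      ⟨_, fun _ => rfl⟩
    have hKJ : ∀ n, J • K n ≤ K (n + 1) := fun n => by
      rw [hK, hK]
      refine le_inf ?_ ?_
      · refine Submodule.smul_le.2 fun b hb y hy => ?_
        have h₁ : φ y ∈ L (c + (n + 1)) := hy.1
        have h₂ := hJL _ (Submodule.smul_mem_smul hb h₁)
        rw [Submodule.mem_comap, map_smul]
        exact h₂
      · rw [hV]
        exact Submodule.smul_mono le_rfl inf_le_right
    have hKstable : ∀ᶠ n in atTop, J • K n = K (n + 1) := by
      refine eventually_smul_eq_of_le (W := U c) (antitone_nat_of_succ_le fun n => ?_) hKJ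
        fun n => ?_
      · rw [hK, hK]
        exact inf_le_inf (Submodule.comap_mono (hL (by lia))) (hVanti (by lia))
      · rw [hK, ← hVdef]
        exact inf_le_right
    have hJ'K : ∀ n, J' • K n ≤ K (n + 1) := fun n =>
      (Submodule.smul_mono hJ'J le_rfl).trans (hKJ n)
    have hJ'L : ∀ n, J' • L (c + n) ≤ L (c + (n + 1)) := fun n =>
      (Submodule.smul_mono hJ'J le_rfl).trans (hJL _)
    have hVfin : ∀ n, relLen (L (c + n)) (V n) ≠ ⊤ := fun n => hlen n ▸ hfin (c + n)
    -- Since `x` carries `K n` into `L`, the remaining generators `a'` suffice, and the induction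
    -- hypothesis applies to the kernel.
    have hKgen : ∀ᶠ n in atTop, K (n + 1) ≤ J' • K n ⊔ L (c + (n + 1)) :=
      hKstable.mono fun n hn => by
        rw [← hn, hsmul]
        refine sup_le_sup le_rfl ?_
        rintro _ ⟨y, hy, rfl⟩
        rw [hK] at hy
        exact hy.1
    have hKfin : ∀ n, relLen (L (c + n)) (K n) ≠ ⊤ := fun n =>
      ne_top_of_le_ne_top (hVfin n) (relLen_mono_right _ ((hK n).le.trans inf_le_right))
    have hLc : Antitone fun n => L (c + n) := fun m n h => hL (by lia)
    obtain ⟨A, hAdeg, hA⟩ := ih a' K (fun n => L (c + n)) hLc hJ'K hJ'L hKgen hKfin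
    -- Modulo `L'` the image of `x` vanishes, so `V (n + 1)` over `L' n` is the cokernel and again
    -- needs only the generators `a'`.
    obtain ⟨L', hL'⟩ : ∃ L' : ℕ → Submodule R N, ∀ n, L' n = (V n).map φ ⊔ L (c + (n + 1)) :=
      ⟨_, fun _ => rfl⟩
    have hL'anti : Antitone L' := fun m n h => by
      rw [hL', hL']
      exact sup_le_sup (Submodule.map_mono (hVanti h)) (hL (by lia))
    have hJ'V : ∀ n, J' • V n ≤ V (n + 1) := fun n => by
      rw [hV]
      exact Submodule.smul_mono hJ'J le_rfl
    have hJ'L' : ∀ n, J' • L' n ≤ L' (n + 1) := fun n => by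
      rw [hL', hL', Submodule.smul_sup, ← Submodule.map_smul'']
      exact sup_le_sup (Submodule.map_mono (hJ'V n)) (hJ'L _)
    have hVgen : ∀ n, V (n + 1 + 1) ≤ J' • V (n + 1) ⊔ L' (n + 1) := fun n => by
      rw [hV (n + 1), hsmul, hL']
      exact sup_le_sup le_rfl le_sup_left
    have hL'fin : ∀ n, relLen (L' n) (V (n + 1)) ≠ ⊤ := fun n =>
      ne_top_of_le_ne_top (hVfin (n + 1)) (relLen_anti_left _ (hL' n ▸ le_sup_right))
    obtain ⟨B, hBdeg, hB⟩ := ih a' (fun n => V (n + 1)) L' hL'anti (fun n => hJ'V (n + 1)) hJ'L'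
      (Eventually.of_forall hVgen) hL'fin
    -- Additivity of length along the kernel and cokernel of multiplication by `x`, arranged without
    -- subtraction.
    have key : ∀ n, relLen (L (c + (n + 1))) (V (n + 1)) + relLen (L (c + n)) (K n) =
        relLen (L (c + n)) (V n) + relLen (L' n) (V (n + 1)) := by
      intro n
      have hφV : (V n).map φ ≤ V (n + 1) := by
        rw [hV, hsmul]; exact le_sup_right
      have h₁ : relLen (L (c + (n + 1))) (L' n ⊓ V (n + 1)) =
          relLen (L (c + (n + 1))) ((V n).map φ) := by
        rw [hL']
        exact relLen_congr_of_le (le_inf le_sup_left hφV) inf_le_left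
      rw [relLen_split (V n) (hLφ n), relLen_comap, hK,
        relLen_split (V (n + 1)) ((hL' n).symm ▸ le_sup_right : L (c + (n + 1)) ≤ L' n), h₁]
      ring
    have hdiff : ∀ᶠ n : ℕ in atTop,
        ((relLen (L (c + (n + 1))) (V (n + 1))).toNat : ℚ) - (relLen (L (c + n)) (V n)).toNat =
          (B - A).eval (n : ℚ) := by
      filter_upwards [hA, hB] with n hAn hBn
      rw [eval_sub, ← hAn, ← hBn]
      have := congrArg ENat.toNat (key n)
      rw [ENat.toNat_add (hVfin _) (hKfin n), ENat.toNat_add (hVfin _) (hL'fin n)] at this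
      have h : (((relLen (L (c + (n + 1))) (V (n + 1))).toNat + (relLen (L (c + n)) (K n)).toNat : ℕ)
        : ℚ) = _ := congrArg Nat.cast this
      push_cast at h
      linarith
    obtain ⟨Q, hQdeg, hQ⟩ := eventually_poly_of_difference
      (f := fun n => ((relLen (L (c + n)) (V n)).toNat : ℚ))
      ((degree_sub_le _ _).trans_lt (max_lt hBdeg hAdeg)) hdiff
    refine ⟨Q.comp (X - C (c : ℚ)), ?_, ?_⟩
    · by_cases h0 : Q = 0
      · simp only [h0, zero_comp, degree_zero]
        exact WithBot.bot_lt_coe _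
      · have hnd : (Q.comp (X - C (c : ℚ))).natDegree = Q.natDegree := by
          rw [natDegree_comp, natDegree_X_sub_C, mul_one]
        refine degree_le_natDegree.trans_lt ?_
        rw [hnd]
        exact_mod_cast (natDegree_lt_iff_degree_lt h0).2 hQdeg
    · obtain ⟨d, hd⟩ := eventually_atTop.1 hQ
      refine eventually_atTop.2 ⟨c + d, fun n hn => ?_⟩
      obtain ⟨k, rfl⟩ : ∃ k, n = c + k := ⟨n - c, by lia⟩
      rw [hlen, hd k (by lia)]
      simp

end Hilbert
end IrPoly

namespace IrPoly

/-! ### Functions bounded by polynomials. -/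

section PolyBounded

open Polynomial Filter

/-- `f` is eventually finite and bounded by a polynomial of degree less than `d`. -/
def PolyBounded (d : ℕ) (f : ℕ → ℕ∞) : Prop :=
  ∃ q : ℚ[X], q.degree < d ∧ ∀ᶠ n : ℕ in atTop, ∃ k : ℕ, f n = k ∧ (k : ℚ) ≤ q.eval (n : ℚ)

theorem PolyBounded.mono {d : ℕ} {f g : ℕ → ℕ∞} (hg : PolyBounded d g)
    (h : ∀ᶠ n in atTop, f n ≤ g n) : PolyBounded d f := by
  obtain ⟨q, hq, hgq⟩ := hg
  refine ⟨q, hq, ?_⟩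
  filter_upwards [hgq, h] with n ⟨k, hk, hkq⟩ hn
  rw [hk] at hn
  obtain ⟨j, hj⟩ := ENat.ne_top_iff_exists.1 (ne_top_of_le_ne_top (ENat.natCast_ne_top k) hn)
  refine ⟨j, hj.symm, le_trans ?_ hkq⟩
  rw [← hj] at hn
  exact_mod_cast hn

theorem degree_comp_X_add_C_lt {q : ℚ[X]} {d : ℕ} (hq : q.degree < d) (c : ℚ) :
    (q.comp (X + C c)).degree < d := by
  by_cases h0 : q = 0
  · simp only [h0, zero_comp, degree_zero]
    exact WithBot.bot_lt_coe _
  · refine degree_le_natDegree.trans_lt ?_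
    rw [natDegree_comp, natDegree_X_add_C, mul_one]
    exact_mod_cast (natDegree_lt_iff_degree_lt h0).2 hq

theorem PolyBounded.shift {d : ℕ} {f : ℕ → ℕ∞} (hf : PolyBounded d f) (c : ℕ) :
    PolyBounded d fun n => f (n + c) := by
  obtain ⟨q, hq, hfq⟩ := hf
  refine ⟨q.comp (X + C (c : ℚ)), degree_comp_X_add_C_lt hq _, ?_⟩
  filter_upwards [(tendsto_add_atTop_nat c).eventually hfq] with n ⟨k, hk, hkq⟩
  exact ⟨k, hk, by simpa using hkq⟩

theorem PolyBounded.const_mul {d : ℕ} {f : ℕ → ℕ∞} (hf : PolyBounded d f) (c : ℕ) :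
    PolyBounded d fun n => c * f n := by
  obtain ⟨q, hq, hfq⟩ := hf
  refine ⟨C (c : ℚ) * q, ?_, ?_⟩
  · refine lt_of_le_of_lt ?_ hq
    rcases eq_or_ne (c : ℚ) 0 with h | h
    · simp [h]
    · rw [degree_C_mul h]
  filter_upwards [hfq] with n ⟨k, hk, hkq⟩
  refine ⟨c * k, by rw [hk]; push_cast; rfl, ?_⟩
  rw [eval_mul, eval_C]
  push_cast
  exact mul_le_mul_of_nonneg_left hkq (by positivity)

theorem PolyBounded.of_difference {d : ℕ} {f g : ℕ → ℕ∞} (hg : PolyBounded d g)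
    (hf : ∀ n, f n ≠ ⊤) (h : ∀ n, f (n + 1) ≤ f n + g n) : PolyBounded (d + 1) f := by
  obtain ⟨q, hq, hgq⟩ := hg
  obtain ⟨Q, hQ, hQq⟩ := exists_antidifference q hq
  obtain ⟨c, hc⟩ := eventually_atTop.1 hgq
  refine ⟨Q + C ((f c).toNat - Q.eval (c : ℚ)), ?_, eventually_atTop.2 ⟨c, fun n hn => ?_⟩⟩
  · refine (degree_add_le _ _).trans_lt (max_lt hQ (degree_C_le.trans_lt ?_))
    exact_mod_cast Nat.succ_pos d
  · induction n, hn using Nat.le_induction with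
    | base => exact ⟨(f c).toNat, (ENat.natCast_toNat (hf c)).symm, by simp⟩
    | succ n hn ih =>
      obtain ⟨k, hk, hkq⟩ := ih
      obtain ⟨j, hj, hjq⟩ := hc n hn
      have h₁ := h n
      obtain ⟨i, hi⟩ := ENat.ne_top_iff_exists.1 (hf (n + 1))
      rw [hk, hj, ← hi] at h₁
      refine ⟨i, hi.symm, ?_⟩
      have h₂ : (i : ℚ) ≤ k + j := by exact_mod_cast h₁
      have h₃ := hQq n
      simp only [eval_add, eval_C, Nat.cast_add, Nat.cast_one] at hkq ⊢
      linarith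

/-- If `q` had smaller degree, `q / P` would tend to zero, although it is at least one wherever `P`
is positive. -/
theorem degree_le_of_eventually_le {P q : ℚ[X]}
    (h : ∀ᶠ n : ℕ in atTop, 0 ≤ P.eval (n : ℚ) ∧ P.eval (n : ℚ) ≤ q.eval (n : ℚ)) :
    P.degree ≤ q.degree := by
  by_contra! hlt
  have hP : P ≠ 0 := by
    rintro rfl
    simp at hlt
  have h₁ : Tendsto (fun n : ℕ => q.eval (n : ℚ) / P.eval (n : ℚ)) atTop (nhds 0) :=
    (div_tendsto_atTop_zero_of_degree_lt q P hlt).comp tendsto_natCast_atTop_atTop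
  have h₂ : ∀ᶠ n : ℕ in atTop, P.eval (n : ℚ) ≠ 0 := by
    have := P.eventually_atTop_not_isRoot hP
    exact tendsto_natCast_atTop_atTop.eventually this
  have h₃ := h₁.eventually (gt_mem_nhds (show (0 : ℚ) < 1 by norm_num))
  obtain ⟨n, hn, hn', hn''⟩ := (h.and (h₂.and h₃)).exists
  have hpos : 0 < P.eval (n : ℚ) := lt_of_le_of_ne hn.1 hn'.symm
  rw [div_lt_one hpos] at hn''
  linarith [hn.2]

theorem PolyBounded.degree_lt {d : ℕ} {f : ℕ → ℕ∞} (hf : PolyBounded d f) {P : ℚ[X]}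
    (hP : ∀ᶠ n : ℕ in atTop, ((f n).toNat : ℚ) = P.eval (n : ℚ)) : P.degree < d := by
  obtain ⟨q, hq, hfq⟩ := hf
  refine (degree_le_of_eventually_le ?_).trans_lt hq
  filter_upwards [hP, hfq] with n hn ⟨k, hk, hkq⟩
  rw [hk, ENat.toNat_natCast] at hn
  rw [← hn]
  exact ⟨by positivity, hkq⟩

theorem PolyBounded.of_eq {d : ℕ} {f : ℕ → ℕ∞} {P : ℚ[X]} (hf : ∀ᶠ n in atTop, f n ≠ ⊤)
    (hd : P.degree < d) (hP : ∀ᶠ n : ℕ in atTop, ((f n).toNat : ℚ) ≤ P.eval (n : ℚ)) :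
    PolyBounded d f := by
  refine ⟨P, hd, ?_⟩
  filter_upwards [hf, hP] with n hn hn'
  exact ⟨_, (ENat.natCast_toNat hn).symm, hn'⟩

/-- A translate has the same leading term, which cancels in the difference. -/
theorem degree_comp_X_add_C_sub_lt {Q : ℚ[X]} {d : ℕ} (hQ : Q.degree < (d + 1 : ℕ)) (c : ℚ) :
    (Q.comp (X + C c) - Q).degree < d := by
  by_cases h0 : Q = 0
  · simp only [h0, zero_comp, sub_zero, degree_zero]
    exact WithBot.bot_lt_coe _
  have h1 : Q.comp (X + C c) ≠ 0 := by
    rw [Ne, comp_eq_zero_iff]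
    rintro (h | ⟨_, h⟩)
    · exact h0 h
    · have := congrArg natDegree h
      rw [natDegree_X_add_C, natDegree_C] at this
      exact one_ne_zero this
  have hnd : (Q.comp (X + C c)).natDegree = Q.natDegree := by
    rw [natDegree_comp, natDegree_X_add_C, mul_one]
  have h2 : (Q.comp (X + C c) - Q).degree < (Q.comp (X + C c)).degree := by
    refine degree_sub_lt_left ?_ h1 ?_
    · rw [degree_eq_natDegree h0, degree_eq_natDegree h1, hnd]
    · rw [leadingCoeff_comp (by rw [natDegree_X_add_C]; exact one_ne_zero), leadingCoeff_X_add_C,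
        one_pow, mul_one]
  refine h2.trans_le ?_
  rw [degree_eq_natDegree h1, hnd]
  have := (natDegree_lt_iff_degree_lt h0).2 hQ
  exact_mod_cast Nat.lt_succ_iff.1 this

end PolyBounded

/-! ### Hilbert–Samuel functions and dimension. -/

section HilbertSamuel

open Polynomial Filter

variable {R : Type*} [CommRing R] {N : Type*} [AddCommGroup N] [Module R N]
  {N' : Type*} [AddCommGroup N'] [Module R N']

/-- The Hilbert–Samuel function: the length of `N / Iⁿ N`. -/
noncomputable def samuel (I : Ideal R) (N : Type*) [AddCommGroup N] [Module R N] (n : ℕ) : ℕ∞ :=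
  relLen (I ^ n • (⊤ : Submodule R N)) ⊤

theorem samuel_succ (I : Ideal R) (n : ℕ) : samuel I N (n + 1) =
    relLen (I ^ (n + 1) • (⊤ : Submodule R N)) (I ^ n • ⊤) + samuel I N n :=
  relLen_add (Submodule.smul_mono_left (Ideal.pow_le_pow_right n.le_succ)) le_top

theorem samuel_mono (I : Ideal R) : Monotone (samuel I N) :=
  monotone_nat_of_le_succ fun n => by rw [samuel_succ]; exact le_add_self

theorem samuel_zero (I : Ideal R) : samuel I N 0 = 0 := by
  rw [samuel, relLen_eq_zero]
  simp

theorem samuel_le_of_surjective (I : Ideal R) (g : N →ₗ[R] N') (hg : Function.Surjective g)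
    (n : ℕ) : samuel I N' n ≤ samuel I N n := by
  have h : (⊤ : Submodule R N).map g = ⊤ := by rw [Submodule.map_top, LinearMap.range_eq_top.2 hg]
  rw [samuel, ← h, ← relLen_comap, h]
  refine relLen_anti_left _ ?_
  rw [← Submodule.map_le_iff_le_comap, Submodule.map_smul'', h]

variable [IsNoetherianRing R]

theorem exists_comap_pow_smul_le [Module.Finite R N'] (I : Ideal R) (f : N →ₗ[R] N') :
    ∃ c, ∀ n, (I ^ (n + c) • (⊤ : Submodule R N')).comap f ≤ I ^ n • ⊤ ⊔ LinearMap.ker f := by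
  obtain ⟨c, hc⟩ := I.exists_pow_inf_eq_pow_smul (LinearMap.range f)
  refine ⟨c, fun n => ?_⟩
  rw [← Submodule.comap_map_eq, Submodule.map_smul'', Submodule.map_top]
  intro x hx
  have h : f x ∈ I ^ (n + c) • ⊤ ⊓ LinearMap.range f := ⟨hx, x, rfl⟩
  rw [hc _ (by lia), Nat.add_sub_cancel] at h
  exact Submodule.smul_mono le_rfl inf_le_right h

theorem exists_samuel_le_relLen_range [Module.Finite R N'] (I : Ideal R) (f : N →ₗ[R] N')
    (hf : Function.Injective f) :
    ∃ c, ∀ n, samuel I N n ≤ relLen (I ^ (n + c) • (⊤ : Submodule R N')) (LinearMap.range f) := by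
  obtain ⟨c, hc⟩ := exists_comap_pow_smul_le I f
  refine ⟨c, fun n => ?_⟩
  rw [← Submodule.map_top, ← relLen_comap]
  refine relLen_anti_left _ ((hc n).trans ?_)
  rw [LinearMap.ker_eq_bot.2 hf, sup_bot_eq]

theorem exists_samuel_le_of_injective [Module.Finite R N'] (I : Ideal R) (f : N →ₗ[R] N')
    (hf : Function.Injective f) : ∃ c, ∀ n, samuel I N n ≤ samuel I N' (n + c) := by
  obtain ⟨c, hc⟩ := exists_samuel_le_relLen_range I f hf
  exact ⟨c, fun n => (hc n).trans (relLen_mono_right _ le_top)⟩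

/-- The range of `f` lies in `ker g`, so its length modulo `Iⁿ⁺ᶜ N` adds to that of the quotient of
`N'`; Artin–Rees bounds the former below by `samuel I N n`. When the function of `N` is polynomial,
that of `N'` is therefore bounded by a difference of translates, which loses one degree. -/
theorem exists_samuel_add_le [Module.Finite R N] (I : Ideal R) (f : N →ₗ[R] N)
    (hf : Function.Injective f) (g : N →ₗ[R] N') (hg : Function.Surjective g)
    (hfg : ∀ x, g (f x) = 0) :
    ∃ c, ∀ n, samuel I N n + samuel I N' (n + c) ≤ samuel I N (n + c) := by
  obtain ⟨c, hc⟩ := exists_samuel_le_relLen_range I f hf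
  refine ⟨c, fun n => ?_⟩
  have h : (⊤ : Submodule R N).map g = ⊤ := by rw [Submodule.map_top, LinearMap.range_eq_top.2 hg]
  have hle : I ^ (n + c) • ⊤ ≤ (I ^ (n + c) • (⊤ : Submodule R N')).comap g := by
    rw [← Submodule.map_le_iff_le_comap, Submodule.map_smul'', h]
  rw [samuel.eq_def I N (n + c), relLen_split _ hle, relLen_comap, h]
  refine add_le_add ((hc n).trans ?_) le_rfl
  refine relLen_mono_right _ (le_inf ?_ le_top)
  rintro _ ⟨x, rfl⟩
  rw [Submodule.mem_comap, hfg]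
  exact Submodule.zero_mem _

theorem exists_samuel_polynomial [Module.Finite R N] (I : Ideal R)
    (h : ∀ n, samuel I N n ≠ ⊤) :
    ∃ P : ℚ[X], ∀ᶠ n : ℕ in atTop, ((samuel I N n).toNat : ℚ) = P.eval (n : ℚ) := by
  obtain ⟨r, a, ha⟩ := Submodule.fg_iff_exists_fin_generating_family.1
    (IsNoetherian.noetherian I)
  have hfin : ∀ n, relLen (I ^ (n + 1) • (⊤ : Submodule R N)) (I ^ n • ⊤) ≠ ⊤ := fun n =>
    ne_top_of_le_ne_top (h (n + 1)) (samuel_succ (N := N) I n ▸ le_self_add)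
  have hsucc : ∀ n, I • (I ^ n • (⊤ : Submodule R N)) = I ^ (n + 1) • ⊤ := fun n => by
    rw [pow_succ', mul_smul]
  have ha' : Ideal.span (Set.range a) = I := ha
  obtain ⟨P, hPdeg, hP⟩ := exists_hilbertPolynomial r a (fun n => I ^ n • (⊤ : Submodule R N))
    (fun n => I ^ (n + 1) • (⊤ : Submodule R N))
    (fun m n hmn => Submodule.smul_mono_left (Ideal.pow_le_pow_right (by lia)))
    (fun n => by rw [ha', hsucc])
    (fun n => by rw [ha', hsucc])
    (Eventually.of_forall fun n => by rw [ha', hsucc]; exact le_sup_left) hfin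
  obtain ⟨Q, -, hQ⟩ := eventually_poly_of_difference
    (f := fun n => ((samuel I N n).toNat : ℚ)) hPdeg (hP.mono fun n hn => by
      rw [← hn, samuel_succ, ENat.toNat_add (hfin n) (h n)]
      push_cast
      ring)
  exact ⟨Q, hQ⟩

omit [IsNoetherianRing R] in
theorem PolyBounded.samuel_ne_top {I : Ideal R} {d : ℕ} (h : PolyBounded d (samuel I N)) (n : ℕ) :
    samuel I N n ≠ ⊤ := by
  obtain ⟨q, -, h⟩ := h
  obtain ⟨m, ⟨k, hk, -⟩, hm⟩ := (h.and (eventually_ge_atTop n)).exists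
  exact ne_top_of_le_ne_top (hk ▸ ENat.natCast_ne_top k) (samuel_mono (N := N) I hm)

/-- The length of a chain of primes starting at `p` is bounded by the degree of the
Hilbert–Samuel function of `R / p`. -/
theorem length_lt_of_polyBounded_samuel [IsLocalRing R] (I : Ideal R)
    (hI : I ≤ IsLocalRing.maximalIdeal R) :
    ∀ (d : ℕ) (s : LTSeries (PrimeSpectrum R)),
      PolyBounded d (samuel I (R ⧸ s.head.asIdeal)) → s.length < d := by
  intro d
  induction d with
  | zero =>
    intro s ⟨q, hq, h⟩
    have hq0 : q = 0 := degree_eq_bot.1 (Nat.WithBot.lt_zero_iff.1 hq)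
    obtain ⟨n, ⟨k, hk, hkq⟩, hn⟩ := (h.and (eventually_ge_atTop 1)).exists
    rw [hq0, eval_zero] at hkq
    have hk0 : k = 0 := by
      have : (k : ℚ) ≤ (0 : ℕ) := by simpa using hkq
      exact Nat.le_zero.1 (by exact_mod_cast this)
    rw [hk0, Nat.cast_zero, samuel, relLen_eq_zero] at hk
    -- The bound zero means that `Iⁿ` times the module is the whole module, with `n ≥ 1`; Nakayama
    -- kills it, but `R / p` is nonzero.
    have hbot : (⊤ : Submodule R (R ⧸ s.head.asIdeal)) = ⊥ :=
      Submodule.eq_bot_of_le_smul_of_le_jacobson_bot (I ^ n) ⊤ Module.Finite.fg_top hk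
        (by
          rw [IsLocalRing.jacobson_eq_maximalIdeal _ bot_ne_top]
          exact (Ideal.pow_le_self (by lia)).trans hI)
    exact absurd hbot top_ne_bot
  | succ d ih =>
    intro s hs
    by_cases hlen : s.length = 0
    · lia
    have h01 : s.head < s 1 := by
      refine s.strictMono (Fin.lt_def.2 ?_)
      have : 1 % (s.length + 1) = 1 := Nat.mod_eq_of_lt (by lia)
      simp [Fin.coe_ofNat_eq_mod, this]
    have hle : s.head.asIdeal ≤ (s 1).asIdeal := h01.le
    obtain ⟨x, hx1, hx0⟩ : ∃ x ∈ (s 1).asIdeal, x ∉ s.head.asIdeal :=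
      SetLike.not_le_iff_exists.1 fun h => h01.not_ge h
    let g : (R ⧸ s.head.asIdeal) →ₗ[R] R ⧸ (s 1).asIdeal :=
      (Ideal.Quotient.factorₐ R hle).toLinearMap
    -- Multiplication by `x` is injective on the domain `R / p₀` and zero on its quotient `R / p₁`.
    obtain ⟨c, hc⟩ := exists_samuel_add_le I (LinearMap.lsmul R (R ⧸ s.head.asIdeal) x)
      (by
        rw [← LinearMap.ker_eq_bot, LinearMap.ker_eq_bot']
        intro y hy
        rw [LinearMap.lsmul_apply, Algebra.smul_def, mul_eq_zero] at hy
        refine hy.resolve_left fun h => hx0 (Ideal.Quotient.eq_zero_iff_mem.1 h))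
      g (Ideal.Quotient.factor_surjective hle)
      (fun y => by
        rw [LinearMap.lsmul_apply, map_smul, Algebra.smul_def]
        refine mul_eq_zero_of_left (Ideal.Quotient.eq_zero_iff_mem.2 hx1) _)
    have hfin := hs.samuel_ne_top
    obtain ⟨Q, hQ⟩ := exists_samuel_polynomial I hfin
    have hQd := hs.degree_lt hQ
    have h1 : PolyBounded d (samuel I (R ⧸ (s 1).asIdeal)) := by
      have h : PolyBounded d fun n => samuel I (R ⧸ (s 1).asIdeal) (n + c) := by
        refine PolyBounded.of_eq (P := Q.comp (X + C (c : ℚ)) - Q)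
          (Eventually.of_forall fun n => ?_) (degree_comp_X_add_C_sub_lt hQd c) ?_
        · exact ne_top_of_le_ne_top (hfin (n + c)) (le_add_self.trans (hc n))
        · filter_upwards [hQ, (tendsto_add_atTop_nat c).eventually hQ] with n hn hn'
          have h₁ := hc n
          have h₂ : samuel I (R ⧸ (s 1).asIdeal) (n + c) ≠ ⊤ :=
            ne_top_of_le_ne_top (hfin (n + c)) (le_add_self.trans (hc n))
          have h₃ := ENat.toNat_le_toNat h₁ (hfin (n + c))
          rw [ENat.toNat_add (hfin n) h₂] at h₃
          have h₄ : (((samuel I (R ⧸ s.head.asIdeal) n).toNat +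
            (samuel I (R ⧸ (s 1).asIdeal) (n + c)).toNat : ℕ) : ℚ) ≤ _ := Nat.cast_le.2 h₃
          push_cast at h₄ hn'
          simp only [eval_sub, eval_comp, eval_add, eval_X, eval_C]
          rw [← hn, ← hn']
          linarith
      exact h.mono (Eventually.of_forall fun n => samuel_mono I (Nat.le_add_right n c))
    have := ih (s.tail hlen) (by rwa [RelSeries.head_tail])
    rw [RelSeries.tail_length] at this
    lia

/-- A chain in the support starts above a minimal prime `p` of the annihilator. As `p` is
associated, `R / p` embeds in `N`, and `R / s.head` is a quotient of `R / p`; the growth bound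
passes to both, up to a shift. -/
theorem supportDim_le_of_polyBounded_samuel [IsLocalRing R] [Module.Finite R N] (I : Ideal R)
    (hI : I ≤ IsLocalRing.maximalIdeal R) {d : ℕ} (h : PolyBounded (d + 1) (samuel I N)) :
    Module.supportDim R N ≤ d := by
  refine iSup_le fun s => ?_
  let t : LTSeries (PrimeSpectrum R) := s.map Subtype.val fun _ _ h => h
  have hmem : t.head ∈ Module.support R N := s.head.2
  rw [Module.mem_support_iff_of_finite] at hmem
  obtain ⟨p, hp, hple⟩ := Ideal.exists_minimalPrimes_le hmem
  have hass := Module.associatedPrimes.minimalPrimes_annihilator_subset_associatedPrimes R N hp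
  obtain ⟨-, f, hf⟩ := (isAssociatedPrime_iff_exists_injective_linearMap _ _).1 hass
  obtain ⟨c, hc⟩ := exists_samuel_le_of_injective I f hf
  have h₁ : PolyBounded (d + 1) (samuel I (R ⧸ p)) :=
    (h.shift c).mono (Eventually.of_forall hc)
  have h₂ : PolyBounded (d + 1) (samuel I (R ⧸ t.head.asIdeal)) :=
    h₁.mono (Eventually.of_forall fun n => samuel_le_of_surjective I
      (Ideal.Quotient.factorₐ R hple).toLinearMap (Ideal.Quotient.factor_surjective hple) n)
  have := length_lt_of_polyBounded_samuel I hI (d + 1) t h₂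
  have h' : s.length ≤ d := Nat.lt_succ_iff.1 this
  exact_mod_cast h'

end HilbertSamuel
end IrPoly

namespace IrPoly

/-! ### Residual submodules `(L : J)`. -/

section Residual

variable {R : Type*} [CommRing R] {N : Type*} [AddCommGroup N] [Module R N]

/-- The residual submodule `(L : J) = {x | J x ⊆ L}`. -/
def residual (J : Ideal R) (L : Submodule R N) : Submodule R N where
  carrier := {x | ∀ a ∈ J, a • x ∈ L}
  add_mem' hx hy a ha := by rw [smul_add]; exact L.add_mem (hx a ha) (hy a ha)
  zero_mem' a _ := by rw [smul_zero]; exact L.zero_mem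
  smul_mem' r x hx a ha := by rw [smul_comm]; exact L.smul_mem r (hx a ha)

theorem le_residual (J : Ideal R) (L : Submodule R N) : L ≤ residual J L :=
  fun _ hx a _ => L.smul_mem a hx

theorem residual_mono (J : Ideal R) {L L' : Submodule R N} (h : L ≤ L') :
    residual J L ≤ residual J L' := fun _ hx a ha => h (hx a ha)

theorem le_residual_iff {J : Ideal R} {L U : Submodule R N} : U ≤ residual J L ↔ J • U ≤ L := by
  rw [Submodule.smul_le]
  exact ⟨fun h a ha x hx => h hx a ha, fun h x hx a ha => h a ha x hx⟩

theorem mem_residual_span {s : Set R} {L : Submodule R N} {x : N} :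
    x ∈ residual (Ideal.span s) L ↔ ∀ a ∈ s, a • x ∈ L := by
  refine ⟨fun h a ha => h a (Ideal.subset_span ha), fun h a ha => ?_⟩
  have : Ideal.span s ≤ L.comap (LinearMap.toSpanSingleton R N x) := Ideal.span_le.2 h
  exact this ha

theorem smul_residual_le (I J : Ideal R) (L : Submodule R N) :
    I • residual J L ≤ residual J (I • L) := by
  rw [le_residual_iff, ← mul_smul, mul_comm, mul_smul]
  exact Submodule.smul_mono le_rfl (le_residual_iff.1 le_rfl)

theorem relLen_sup_le (L A B : Submodule R N) :
    relLen L (A ⊔ B) ≤ relLen L A + relLen L B := by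
  rw [← relLen_sup_left L (A ⊔ B), ← sup_assoc,
    relLen_add (le_sup_left : L ≤ L ⊔ A) le_sup_left, relLen_sup_left, relLen_sup_left]
  gcongr
  exact relLen_anti_left _ le_sup_left

theorem relLen_inf_le (A B U : Submodule R N) :
    relLen (A ⊓ B) U ≤ relLen A U + relLen B U := by
  rw [relLen_split U (inf_le_left : A ⊓ B ≤ A), add_comm]
  gcongr
  calc relLen (A ⊓ B) (A ⊓ U) = relLen (B ⊓ (A ⊓ U)) (A ⊓ U) := by
        rw [← relLen_inf_left (A ⊓ B)]
        congr 1
        ext x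
        simp only [Submodule.mem_inf]
        tauto
    _ = relLen B (A ⊓ U) := relLen_inf_left _ _
    _ ≤ relLen B U := relLen_mono_right _ inf_le_right

theorem relLen_finset_inf_le {ι : Type*} (s : Finset ι) (A : ι → Submodule R N)
    (U : Submodule R N) : relLen (s.inf A) U ≤ ∑ i ∈ s, relLen (A i) U := by
  classical
  induction s using Finset.induction_on with
  | empty => simp [relLen_eq_zero.2 le_top]
  | insert i s hi ih =>
    rw [Finset.inf_insert, Finset.sum_insert hi]
    exact (relLen_inf_le _ _ _).trans (add_le_add le_rfl ih)

theorem relLen_top_eq_one {m : Ideal R} (hm : m.IsMaximal) :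
    relLen (m : Submodule R R) ⊤ = 1 := by
  have : IsSimpleModule R (R ⧸ m) := isSimpleModule_iff_isCoatom.2 hm.out
  rw [relLen, Submodule.map_top, Submodule.range_mkQ, Module.length_top]
  exact Module.length_eq_one R (R ⧸ m)

theorem relLen_span_singleton_le_one {m : Ideal R} (hm : m.IsMaximal) {L : Submodule R N} {x : N}
    (hx : x ∈ residual m L) : relLen L (Submodule.span R {x}) ≤ 1 := by
  rw [← LinearMap.range_toSpanSingleton, ← Submodule.map_top, ← relLen_comap,
    ← relLen_top_eq_one hm]
  exact relLen_anti_left _ fun a ha => hx a ha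

theorem relLen_ne_top_of_le_residual [IsNoetherian R N] {m : Ideal R} (hm : m.IsMaximal)
    {L U : Submodule R N} (h : U ≤ residual m L) : relLen L U ≠ ⊤ := by
  have hfg : U.FG := IsNoetherian.noetherian U
  induction U, hfg using Submodule.fg_induction with
  | singleton x =>
    exact ne_top_of_le_ne_top ENat.one_ne_top
      (relLen_span_singleton_le_one hm (h (Submodule.mem_span_singleton_self x)))
  | sup A B _ _ hA hB =>
    refine ne_top_of_le_ne_top ?_ (relLen_sup_le L A B)
    exact WithTop.add_ne_top.2 ⟨hA (le_sup_left.trans h), hB (le_sup_right.trans h)⟩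

/-- The length of a module killed by a power of `J` is bounded by a multiple of the length of the
part killed by `J`. -/
theorem exists_relLen_residual_pow_le {J : Ideal R} (hJ : J.FG) (s : ℕ) :
    ∃ C : ℕ, ∀ L : Submodule R N,
      relLen L (residual (J ^ s) L) ≤ C * relLen L (residual J L) := by
  obtain ⟨t, ht⟩ := hJ
  induction s with
  | zero =>
    refine ⟨0, fun L => ?_⟩
    rw [relLen_eq_zero.2]
    · exact bot_le
    · intro x hx
      simpa using hx 1 (by simp)
  | succ s ih =>
    obtain ⟨C, hC⟩ := ih
    refine ⟨1 + t.card * C, fun L => ?_⟩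
    -- `(L : J)` is the intersection of the preimages of `L` under the generators of `J`, and each
    -- generator carries `(L : Jˢ⁺¹)` into `(L : Jˢ)`. The constant depends on the number of
    -- generators and on `s`, not on `L`.
    have hinf : residual J L = t.inf fun a => L.comap (LinearMap.lsmul R N a) := by
      ext x
      rw [← ht]
      simp [mem_residual_span, Submodule.mem_finsetInf]
    have hterm : ∀ a ∈ t, relLen (L.comap (LinearMap.lsmul R N a)) (residual (J ^ (s + 1)) L) ≤
        C * relLen L (residual J L) := by
      intro a ha
      rw [relLen_comap]
      refine le_trans (relLen_mono_right _ ?_) (hC L)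
      rintro _ ⟨x, hx, rfl⟩ b hb
      rw [LinearMap.lsmul_apply, smul_smul]
      refine hx _ ?_
      rw [pow_succ]
      exact Ideal.mul_mem_mul hb (ht ▸ Ideal.subset_span ha)
    have h₁ : relLen (residual J L) (residual (J ^ (s + 1)) L) ≤
        t.card * (C * relLen L (residual J L)) := by
      have := relLen_finset_inf_le t (fun a => L.comap (LinearMap.lsmul R N a))
        (residual (J ^ (s + 1)) L)
      rw [← hinf] at this
      refine this.trans ((Finset.sum_le_card_nsmul _ _ _ hterm).trans_eq ?_)
      rw [nsmul_eq_mul]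
    refine (relLen_le_add L (residual J L) _).trans ((add_le_add le_rfl h₁).trans_eq ?_)
    push_cast
    ring

end Residual

/-! ### Socle lengths of `N / Iⁿ N` over a local ring. -/

section SoclePolynomial

open Polynomial Filter

variable {R : Type*} [CommRing R] [IsNoetherianRing R] {N : Type*} [AddCommGroup N] [Module R N]
  [Module.Finite R N]

omit [IsNoetherianRing R] [Module.Finite R N] in
theorem mem_smul_pi {ι : Type*} [Finite ι] (J : Ideal R) (W : Submodule R N) {v : ι → N}
    (hv : ∀ i, v i ∈ J • W) : v ∈ J • Submodule.pi Set.univ (fun _ : ι => W) := by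
  classical
  have := Fintype.ofFinite ι
  rw [← Finset.univ_sum_single v]
  refine Submodule.sum_mem _ fun i _ => ?_
  have h : (J • W).map (LinearMap.single R (fun _ : ι => N) i) ≤
      J • Submodule.pi Set.univ (fun _ : ι => W) := by
    rw [Submodule.map_smul'']
    refine Submodule.smul_mono le_rfl ?_
    rintro _ ⟨x, hx, rfl⟩ j -
    by_cases hij : j = i
    · subst hij; simpa using hx
    · simp [hij]
  exact h ⟨v i, hv i, rfl⟩

/-- Send `x` to the vector `(aᵢ x)`, where the `aᵢ` generate `m`. The kernel is `(0 : m)`, and the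
images of the residuals are contained in a `J`-adic filtration of a finite power of `N`, where
Artin–Rees applies. -/
theorem eventually_residual_le {J : Ideal R} {V : ℕ → Submodule R N} (hV : Antitone V)
    (hJV : ∀ n, J • V n ≤ V (n + 1)) (hgen : ∀ᶠ n in atTop, V (n + 1) ≤ J • V n) (m : Ideal R) :
    ∀ᶠ n in atTop, residual m (V (n + 1)) ≤ J • residual m (V n) ⊔ residual m ⊥ := by
  obtain ⟨r, a, ha⟩ := Submodule.fg_iff_exists_fin_generating_family.1 (IsNoetherian.noetherian m)
  have ha' : Ideal.span (Set.range a) = m := ha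
  obtain ⟨c, hc⟩ := eventually_atTop.1 hgen
  let φ : N →ₗ[R] Fin r → N := LinearMap.pi fun i => LinearMap.lsmul R N (a i)
  have hφ : ∀ L : Submodule R N, (Submodule.pi Set.univ fun _ => L).comap φ = residual m L := by
    intro L
    ext x
    rw [← ha', mem_residual_span]
    simp [φ, Submodule.mem_pi]
  have hker : LinearMap.ker φ = residual m ⊥ := by
    rw [← hφ ⊥]
    ext x
    simp [funext_iff]
  have hVc : ∀ n, V (c + n) ≤ J ^ n • V c := by
    intro n
    induction n with
    | zero => simp
    | succ n ih =>
      rw [pow_succ', mul_smul]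
      exact (hc (c + n) (by lia)).trans (Submodule.smul_mono le_rfl ih)
  have key : ∀ᶠ n in atTop, J • (residual m (V (c + n))).map φ =
      (residual m (V (c + (n + 1)))).map φ := by
    refine eventually_smul_eq_of_le (K := fun n => (residual m (V (c + n))).map φ)
      (W := Submodule.pi Set.univ fun _ => V c)
      (fun i j hij => Submodule.map_mono (residual_mono _ (hV (by lia)))) (fun n => ?_)
      (fun n => ?_)
    · rw [← Submodule.map_smul'']
      exact Submodule.map_mono ((smul_residual_le _ _ _).trans (residual_mono _ (hJV _)))
    · rw [Submodule.map_le_iff_le_comap]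
      intro x hx
      refine mem_smul_pi _ _ fun i => hVc n ?_
      exact hx _ (ha' ▸ Ideal.subset_span ⟨i, rfl⟩)
  obtain ⟨d, hd⟩ := eventually_atTop.1 key
  refine eventually_atTop.2 ⟨c + d, fun n hn => ?_⟩
  obtain ⟨k, rfl⟩ : ∃ k, n = c + k := ⟨n - c, by lia⟩
  have h := hd k (by lia)
  rw [← Submodule.map_smul''] at h
  rw [← hker, ← Submodule.comap_map_eq, h]
  exact Submodule.le_comap_map _ _

/-- By Artin–Rees, `Iⁿ N ∩ K` lies in `I K = 0` for large `n`. -/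
theorem eventually_relLen_const {I : Ideal R} (K : Submodule R N) (hK : I • K = ⊥) :
    ∀ᶠ n in atTop, relLen (I ^ n • (⊤ : Submodule R N)) K = relLen ⊥ K := by
  obtain ⟨c, hc⟩ := I.exists_pow_inf_eq_pow_smul K
  refine eventually_atTop.2 ⟨c + 1, fun n hn => ?_⟩
  rw [← relLen_inf_left, hc n (by lia)]
  congr 1
  rw [eq_bot_iff, ← hK]
  exact Submodule.smul_mono (Ideal.pow_le_self (by lia)) inf_le_right

/-- The length of the socle of `N / V n`, where `V` is eventually `J`-adic. -/
theorem exists_soclePolynomial_of_filtration [IsLocalRing R] {r : ℕ} (a : Fin r → R)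
    {V : ℕ → Submodule R N} (hV : Antitone V)
    (hJV : ∀ n, Ideal.span (Set.range a) • V n ≤ V (n + 1))
    (hgen : ∀ᶠ n in atTop, V (n + 1) ≤ Ideal.span (Set.range a) • V n)
    (hconst : ∃ k, ∀ᶠ n in atTop,
      relLen (V n) (residual (IsLocalRing.maximalIdeal R) ⊥) = k) :
    ∃ P C : ℚ[X], P.degree < r ∧ C.degree < 1 ∧ ∀ᶠ n : ℕ in atTop,
      ((relLen (V n) (residual (IsLocalRing.maximalIdeal R) (V n))).toNat : ℚ) =
        (P + C).eval (n : ℚ) := by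
  set m := IsLocalRing.maximalIdeal R with hm
  obtain ⟨k, hk⟩ := hconst
  have hmax : m.IsMaximal := IsLocalRing.maximalIdeal.isMaximal R
  have hanti : Antitone fun n => residual m ⊥ ⊔ V n := fun i j hij => sup_le_sup le_rfl (hV hij)
  have hfin : ∀ n, relLen (V n) (residual m (V n)) ≠ ⊤ := fun n =>
    relLen_ne_top_of_le_residual hmax le_rfl
  have hfin' : ∀ n, relLen (residual m ⊥ ⊔ V n) (residual m (V n)) ≠ ⊤ := fun n =>
    ne_top_of_le_ne_top (hfin n) (relLen_anti_left _ le_sup_right)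
  -- The socle splits into the contribution of the fixed submodule `(0 : m)`, eventually constant,
  -- and the rest, whose residuals are eventually generated by `J`.
  obtain ⟨P, hPd, hP⟩ := exists_hilbertPolynomial r a (fun n => residual m (V n))
    (fun n => residual m ⊥ ⊔ V n) hanti
    (fun n => (smul_residual_le _ _ _).trans (residual_mono _ (hJV n)))
    (fun n => by
      rw [Submodule.smul_sup]
      exact sup_le_sup Submodule.smul_le_right (hJV n))
    ((eventually_residual_le hV hJV hgen m).mono fun n hn =>
      hn.trans (sup_le_sup le_rfl le_sup_left)) hfin'
  refine ⟨P, C (k.toNat : ℚ), hPd, degree_C_lt, ?_⟩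
  filter_upwards [hP, hk] with n hn hkn
  have hsplit : relLen (V n) (residual m (V n)) = relLen (V n) (residual m ⊥) +
      relLen (residual m ⊥ ⊔ V n) (residual m (V n)) := by
    rw [relLen_add (le_sup_right : V n ≤ residual m ⊥ ⊔ V n)
      (sup_le (residual_mono _ bot_le) (le_residual _ _)), sup_comm, relLen_sup_left]
  have h₁ : relLen (V n) (residual m ⊥) ≠ ⊤ :=
    relLen_ne_top_of_le_residual hmax (residual_mono _ bot_le)
  rw [hsplit, ENat.toNat_add h₁ (hfin' n), hkn, eval_add, eval_C, ← hn]
  push_cast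
  ring

/-- The length of the socle of `N / Iⁿ N`. -/
noncomputable def socleLen [IsLocalRing R] (L : Submodule R N) : ℕ∞ :=
  relLen L (residual (IsLocalRing.maximalIdeal R) L)

theorem socleLen_ne_top [IsLocalRing R] (L : Submodule R N) : socleLen L ≠ ⊤ :=
  relLen_ne_top_of_le_residual (IsLocalRing.maximalIdeal.isMaximal R) le_rfl

theorem exists_relLen_socle_const [IsLocalRing R] {I : Ideal R}
    (hI : I ≤ IsLocalRing.maximalIdeal R) {s : ℕ} (hs : s ≠ 0) :
    ∃ k, ∀ᶠ n in atTop, relLen (I ^ (s * n) • (⊤ : Submodule R N))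
      (residual (IsLocalRing.maximalIdeal R) ⊥) = k := by
  refine ⟨_, (tendsto_id.const_mul_atTop' (Nat.pos_of_ne_zero hs)).eventually
    (eventually_relLen_const _ ?_)⟩
  rw [eq_bot_iff]
  exact (Submodule.smul_mono hI le_rfl).trans (le_residual_iff.1 le_rfl)

theorem exists_soclePolynomial [IsLocalRing R] {I : Ideal R}
    (hI : I ≤ IsLocalRing.maximalIdeal R) :
    ∃ P : ℚ[X], ∀ᶠ n : ℕ in atTop,
      ((socleLen (I ^ n • (⊤ : Submodule R N))).toNat : ℚ) = P.eval (n : ℚ) := by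
  obtain ⟨r, a, ha⟩ := Submodule.fg_iff_exists_fin_generating_family.1 (IsNoetherian.noetherian I)
  have ha' : Ideal.span (Set.range a) = I := ha
  have hsucc : ∀ n, I • (I ^ n • (⊤ : Submodule R N)) = I ^ (n + 1) • ⊤ := fun n => by
    rw [pow_succ', mul_smul]
  have hconst := exists_relLen_socle_const (N := N) hI one_ne_zero
  simp only [one_mul] at hconst
  obtain ⟨P, C, -, -, h⟩ := exists_soclePolynomial_of_filtration a
    (V := fun n => I ^ n • (⊤ : Submodule R N))
    (fun i j hij => Submodule.smul_mono_left (Ideal.pow_le_pow_right hij))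
    (fun n => by rw [ha', hsucc])
    (Eventually.of_forall fun n => by rw [ha', hsucc]) hconst
  exact ⟨P + C, h⟩

/-- The filtration `I^(s n) N` is eventually adic for the ideal generated by the `aᵢ`, so `P (s n)`
is a polynomial of degree less than `r` plus a constant. Substituting `s X` preserves degrees, and
`r ≠ 0` leaves room for the constant. -/
theorem degree_soclePolynomial_lt [IsLocalRing R] {I : Ideal R}
    (hI : I ≤ IsLocalRing.maximalIdeal R) {P : ℚ[X]} (hP : ∀ᶠ n : ℕ in atTop,
      ((socleLen (I ^ n • (⊤ : Submodule R N))).toNat : ℚ) = P.eval (n : ℚ))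
    {r s n₀ : ℕ} (hr : r ≠ 0) (hs : s ≠ 0) (a : Fin r → R) (ha : ∀ i, a i ∈ I ^ s)
    (hred : I ^ (n₀ + s) • (⊤ : Submodule R N) ≤ Ideal.span (Set.range a) • I ^ n₀ • ⊤) :
    P.degree < r := by
  have haI : Ideal.span (Set.range a) ≤ I ^ s := by
    rw [Ideal.span_le]
    rintro _ ⟨i, rfl⟩
    exact ha i
  obtain ⟨Q, C, hQ, hC, h⟩ := exists_soclePolynomial_of_filtration a
    (V := fun n => I ^ (s * n) • (⊤ : Submodule R N))
    (fun i j hij => Submodule.smul_mono_left (Ideal.pow_le_pow_right (Nat.mul_le_mul_left s hij)))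
    (fun n => by
      refine (Submodule.smul_mono haI le_rfl).trans_eq ?_
      rw [← mul_smul, ← pow_add, mul_add, mul_one, add_comm])
    (eventually_atTop.2 ⟨n₀, fun n hn => by
      -- As `s n ≥ n₀`, the relation `hred` can be multiplied by the remaining power `Iᵏ`.
      obtain ⟨k, hk⟩ : ∃ k, s * n = k + n₀ :=
        ⟨s * n - n₀, by have := Nat.le_mul_of_pos_left n (Nat.pos_of_ne_zero hs); lia⟩
      have h₁ : s * (n + 1) = k + (n₀ + s) := by rw [mul_add, hk]; ring
      rw [h₁, hk, pow_add I k (n₀ + s), pow_add I k n₀, mul_smul, mul_smul,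
        ← mul_smul (Ideal.span _) (I ^ k), mul_comm, mul_smul]
      exact Submodule.smul_mono le_rfl hred⟩)
    (exists_relLen_socle_const hI hs)
  have hQC : (Q + C).degree < r := by
    refine (degree_add_le _ _).trans_lt (max_lt hQ (hC.trans_le ?_))
    exact_mod_cast Nat.one_le_iff_ne_zero.2 hr
  have hmul := tendsto_id.const_mul_atTop' (Nat.pos_of_ne_zero hs)
  have hPs : ∀ᶠ n : ℕ in atTop, (P.comp (Polynomial.C (s : ℚ) * X)).eval (n : ℚ) =
      (Q + C).eval (n : ℚ) := by
    filter_upwards [h, hmul.eventually hP] with n h₁ h₂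
    rw [← h₁, eval_comp, eval_mul, Polynomial.eval_C, eval_X]
    simp only [id, Nat.cast_mul] at h₂
    rw [← h₂]
    rfl
  have hle : (P.comp (Polynomial.C (s : ℚ) * X)).degree ≤ (Q + C).degree := by
    refine degree_le_of_eventually_le ?_
    filter_upwards [hPs, h] with n h₁ h₂
    refine ⟨?_, h₁.le⟩
    rw [h₁, ← h₂]
    positivity
  by_cases h0 : P = 0
  · rw [h0, degree_zero]
    exact WithBot.bot_lt_coe _
  have hnd : (P.comp (Polynomial.C (s : ℚ) * X)).natDegree = P.natDegree := by
    rw [natDegree_comp, natDegree_C_mul_X _ (by exact_mod_cast hs), mul_one]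
  have h1 : P.comp (Polynomial.C (s : ℚ) * X) ≠ 0 := by
    rw [Ne, comp_eq_zero_iff]
    rintro (h | ⟨_, h⟩)
    · exact h0 h
    · have := congrArg natDegree h
      rw [natDegree_C_mul_X _ (by exact_mod_cast hs), natDegree_C] at this
      exact one_ne_zero this
  rw [degree_eq_natDegree h0, ← hnd, ← degree_eq_natDegree h1]
  exact hle.trans_lt hQC

/-- The module `Iⁿ N / Iⁿ⁺¹ N` is killed by the `s`-th power of the maximal ideal, so its length is
at most a constant times the socle length of `N / Iⁿ⁺¹ N`. Summation raises the degree by one, and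
the Hilbert–Samuel function then bounds the dimension. -/
theorem supportDim_le_of_polyBounded_socleLen [IsLocalRing R] {I : Ideal R}
    (hI : I ≤ IsLocalRing.maximalIdeal R) {s : ℕ}
    (hs : IsLocalRing.maximalIdeal R ^ s • (⊤ : Submodule R N) ≤ I • ⊤) {d : ℕ}
    (h : PolyBounded d fun n => socleLen (I ^ n • (⊤ : Submodule R N))) :
    Module.supportDim R N ≤ d := by
  obtain ⟨C, hC⟩ := exists_relLen_residual_pow_le (N := N)
    (IsNoetherian.noetherian (IsLocalRing.maximalIdeal R)) s
  have hle : ∀ n, relLen (I ^ (n + 1) • (⊤ : Submodule R N)) (I ^ n • ⊤) ≤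
      C * socleLen (I ^ (n + 1) • (⊤ : Submodule R N)) := fun n => by
    refine (relLen_mono_right _ ?_).trans (hC _)
    rw [le_residual_iff, ← mul_smul, mul_comm, mul_smul, pow_succ, mul_smul]
    exact Submodule.smul_mono le_rfl hs
  refine supportDim_le_of_polyBounded_samuel I hI
    (((h.shift 1).const_mul C).of_difference (fun n => ?_) fun n => ?_)
  · induction n with
    | zero => rw [samuel_zero]; exact ENat.zero_ne_top
    | succ n ih =>
      rw [samuel_succ]
      refine WithTop.add_ne_top.2 ⟨ne_top_of_le_ne_top ?_ (hle n), ih⟩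
      exact WithTop.mul_ne_top (ENat.natCast_ne_top _) (socleLen_ne_top _)
  · rw [samuel_succ, add_comm]
    exact add_le_add le_rfl (hle n)

end SoclePolynomial
end IrPoly

namespace IrPoly

/-! ### Socles over a local ring. -/

section LocalSocle

variable {R : Type*} [CommRing R] [IsLocalRing R] {N : Type*} [AddCommGroup N] [Module R N]

omit [IsLocalRing R] in
theorem relLen_pi_top (ι : Type*) [Fintype ι] {m : Ideal R} (hm : m.IsMaximal) :
    relLen (Submodule.pi Set.univ fun _ : ι => (m : Submodule R R)) ⊤ = Fintype.card ι := by
  let h : (ι → R) →ₗ[R] ι → R ⧸ m := LinearMap.pi fun i => m.mkQ ∘ₗ LinearMap.proj i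
  have hh : Function.Surjective h := fun y => by
    choose x hx using fun i => Submodule.mkQ_surjective m (y i)
    exact ⟨x, funext hx⟩
  have hpi : (Submodule.pi Set.univ fun _ : ι => (m : Submodule R R)) = (⊥ : Submodule R _).comap h := by
    ext x
    simp only [Submodule.mem_pi, Submodule.mem_comap, Submodule.mem_bot, funext_iff]
    refine forall_congr' fun i => ?_
    have h : x i ∈ m ↔ m.mkQ (x i) = 0 := (Submodule.Quotient.mk_eq_zero m).symm
    exact ⟨fun hx => h.1 (hx trivial), fun hx _ => h.2 hx⟩
  have : IsSimpleModule R (R ⧸ m) := isSimpleModule_iff_isCoatom.2 hm.out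
  rw [hpi, relLen_comap, Submodule.map_top, LinearMap.range_eq_top.2 hh, relLen,
    Submodule.map_top, Submodule.range_mkQ, Module.length_top,
    (Submodule.quotEquivOfEqBot ⊥ rfl).length_eq, Module.length_pi_of_fintype]
  simp

/-- The preimage of `L` under `c ↦ ∑ cᵢ xᵢ` lies in `𝔪^ι`, so the subquotient spanned by the `xᵢ`
has length at least that of `R^ι / 𝔪^ι`. -/
theorem card_le_socleLen {ι : Type*} [Fintype ι] {L : Submodule R N} (x : ι → N)
    (hx : ∀ i, x i ∈ residual (IsLocalRing.maximalIdeal R) L)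
    (hind : ∀ c : ι → R, ∑ i, c i • x i ∈ L → ∀ i, c i ∈ IsLocalRing.maximalIdeal R) :
    (Fintype.card ι : ℕ∞) ≤ socleLen L := by
  rw [← relLen_pi_top ι (IsLocalRing.maximalIdeal.isMaximal R)]
  refine (relLen_anti_left (L := L.comap (Fintype.linearCombination R x)) _ ?_).trans ?_
  · intro c hc i _
    rw [Submodule.mem_comap, Fintype.linearCombination_apply] at hc
    exact hind c hc i
  · rw [relLen_comap]
    refine relLen_mono_right _ ?_
    rintro _ ⟨c, -, rfl⟩
    rw [Fintype.linearCombination_apply]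
    exact Submodule.sum_mem _ fun i _ => Submodule.smul_mem _ _ (hx i)

theorem socleLen_inf_le (L L' : Submodule R N) : socleLen (L ⊓ L') ≤ socleLen L + socleLen L' :=
  (relLen_inf_le _ _ _).trans (add_le_add (relLen_mono_right _ (residual_mono _ inf_le_left))
    (relLen_mono_right _ (residual_mono _ inf_le_right)))

theorem socleLen_top : socleLen (⊤ : Submodule R N) = 0 := relLen_eq_zero.2 le_top

end LocalSocle

/-! ### Socles of localizations at primes. -/

section PrimeSocle

variable {R : Type*} [CommRing R] {M : Type*} [AddCommGroup M] [Module R M]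

/-- The length of the socle of `(M / N)_p` over `R_p`. -/
noncomputable def primeSocleLen (p : PrimeSpectrum R) (N : Submodule R M) : ℕ∞ :=
  socleLen (N.localized p.asIdeal.primeCompl)

theorem mkLinearMap_mem_localized {S : Submonoid R} {N : Submodule R M} {x : M} :
    LocalizedModule.mkLinearMap S M x ∈ N.localized S ↔ ∃ s : S, s • x ∈ N := by
  rw [Submodule.mem_localized']
  constructor
  · rintro ⟨y, hy, s, h⟩
    rw [IsLocalizedModule.mk'_eq_iff, ← LinearMap.map_smul_of_tower,
      IsLocalizedModule.eq_iff_exists S] at h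
    obtain ⟨c, hc⟩ := h
    refine ⟨c * s, ?_⟩
    rw [mul_smul, ← hc]
    exact N.smul_of_tower_mem c hy
  · rintro ⟨s, hs⟩
    exact ⟨_, hs, s, by rw [IsLocalizedModule.mk'_eq_iff, LinearMap.map_smul_of_tower]⟩

/-- The annihilator of `x` modulo `N` is `p`. -/
def AnnihilatorMod (N : Submodule R M) (p : Ideal R) (x : M) : Prop := ∀ r, r ∈ p ↔ r • x ∈ N

theorem mem_associatedPrimes_quotient [IsNoetherianRing R] {N : Submodule R M} {p : Ideal R} :
    p ∈ associatedPrimes R (M ⧸ N) ↔ p.IsPrime ∧ ∃ x, AnnihilatorMod N p x := by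
  rw [AssociatedPrimes.mem_iff, isAssociatedPrime_iff]
  refine and_congr_right fun _ => ⟨?_, ?_⟩
  · rintro ⟨x, hx⟩
    obtain ⟨y, rfl⟩ := N.mkQ_surjective x
    refine ⟨y, fun r => ?_⟩
    rw [hx, Submodule.mem_colon_singleton, ← map_smul, Submodule.mem_bot, Submodule.mkQ_apply,
      Submodule.Quotient.mk_eq_zero]
  · rintro ⟨y, hy⟩
    refine ⟨N.mkQ y, ?_⟩
    ext r
    rw [hy, Submodule.mem_colon_singleton, ← map_smul, Submodule.mem_bot, Submodule.mkQ_apply,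
      Submodule.Quotient.mk_eq_zero]

variable (p : PrimeSpectrum R)

theorem smul_mem_residual_maximalIdeal {N : Submodule R M} {x : M} :
    LocalizedModule.mkLinearMap p.asIdeal.primeCompl M x ∈
      residual (IsLocalRing.maximalIdeal (Localization.AtPrime p.asIdeal))
        (N.localized p.asIdeal.primeCompl) ↔
    ∀ r ∈ p.asIdeal, ∃ s : p.asIdeal.primeCompl, s • r • x ∈ N := by
  rw [← Localization.AtPrime.map_eq_maximalIdeal, Ideal.map, mem_residual_span, Set.forall_mem_image]
  refine forall₂_congr fun r _ => ?_
  rw [algebraMap_smul, ← map_smul, mkLinearMap_mem_localized]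

theorem card_le_primeSocleLen {ι : Type*} [Fintype ι] {N : Submodule R M} (x : ι → M)
    (hx : ∀ i, ∀ r ∈ p.asIdeal, r • x i ∈ N)
    (hind : ∀ c : ι → R, ∑ i, c i • x i ∈ N → ∀ i, c i ∈ p.asIdeal) :
    (Fintype.card ι : ℕ∞) ≤ primeSocleLen p N := by
  refine card_le_socleLen (fun i => LocalizedModule.mkLinearMap p.asIdeal.primeCompl M (x i))
    (fun i => (smul_mem_residual_maximalIdeal p).2 fun r hr => ⟨1, by simpa using hx i r hr⟩)
    fun c hc => ?_
  -- A common denominator turns the relation over `R_p` into one over `R`; `b` is a unit in `R_p`,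
  -- so membership in the maximal ideal is unaffected.
  obtain ⟨b, hb⟩ := IsLocalization.exist_integer_multiples_of_finite p.asIdeal.primeCompl c
  choose r hr using hb
  have h := Submodule.smul_mem _ (algebraMap R (Localization.AtPrime p.asIdeal) b) hc
  have h' : algebraMap R (Localization.AtPrime p.asIdeal) b •
      ∑ i, c i • LocalizedModule.mkLinearMap p.asIdeal.primeCompl M (x i) =
      LocalizedModule.mkLinearMap p.asIdeal.primeCompl M (∑ i, r i • x i) := by
    rw [Finset.smul_sum, map_sum]
    refine Finset.sum_congr rfl fun i _ => ?_
    rw [smul_smul, map_smul, ← algebraMap_smul (Localization.AtPrime p.asIdeal) (r i), hr,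
      Algebra.smul_def]
  rw [h', mkLinearMap_mem_localized] at h
  obtain ⟨t, ht⟩ := h
  have h₂ : ∑ i, ((t : R) * r i) • x i ∈ N := by
    simpa [Finset.smul_sum, mul_smul, Submonoid.smul_def] using ht
  intro i
  have h₃ : r i ∈ p.asIdeal := (p.2.mem_or_mem (hind _ h₂ i)).resolve_left t.2
  have h₄ := (IsLocalization.AtPrime.to_map_mem_maximal_iff (Localization.AtPrime p.asIdeal)
    p.asIdeal (r i)).2 h₃
  rw [hr, Algebra.smul_def] at h₄
  refine ((IsLocalRing.maximalIdeal.isMaximal _).isPrime.mem_or_mem h₄).resolve_left ?_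
  rw [IsLocalization.AtPrime.to_map_mem_maximal_iff (Localization.AtPrime p.asIdeal) p.asIdeal]
  exact b.2

theorem primeSocleLen_top : primeSocleLen p (⊤ : Submodule R M) = 0 := by
  have h : (⊤ : Submodule R M).localized p.asIdeal.primeCompl = ⊤ := Submodule.localized'_top ..
  rw [primeSocleLen, h, socleLen_top]

theorem primeSocleLen_inf_le (Q Q' : Submodule R M) :
    primeSocleLen p (Q ⊓ Q') ≤ primeSocleLen p Q + primeSocleLen p Q' := by
  have h : (Q ⊓ Q').localized p.asIdeal.primeCompl =
    Q.localized p.asIdeal.primeCompl ⊓ Q'.localized p.asIdeal.primeCompl :=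
      Submodule.localized'_inf ..
  rw [primeSocleLen, h]
  exact socleLen_inf_le _ _

theorem primeSocleLen_finset_inf_le (s : Finset (Submodule R M)) :
    primeSocleLen p (s.inf id) ≤ ∑ Q ∈ s, primeSocleLen p Q := by
  classical
  induction s using Finset.induction_on with
  | empty =>
    rw [Finset.inf_empty, primeSocleLen_top]
    exact bot_le
  | insert Q s hQ ih =>
    rw [Finset.inf_insert, Finset.sum_insert hQ]
    exact (primeSocleLen_inf_le p _ _).trans (add_le_add le_rfl ih)

/-- Clear the denominator of `z`, then multiply by one element outside `p` that works for all of the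
finitely many generators of `p`. Nothing outside `p` can annihilate the result modulo `N`, as this
would put `z` into the localization of `N`. -/
theorem exists_annihilatorMod [IsNoetherianRing R] {N : Submodule R M}
    {z : LocalizedModule.AtPrime p.asIdeal M}
    (hz : z ∈ residual (IsLocalRing.maximalIdeal (Localization.AtPrime p.asIdeal))
        (N.localized p.asIdeal.primeCompl))
    (hzN : z ∉ N.localized p.asIdeal.primeCompl) :
    ∃ (y : M) (s : p.asIdeal.primeCompl), AnnihilatorMod N p.asIdeal y ∧
      LocalizedModule.mkLinearMap p.asIdeal.primeCompl M y = (s : R) • z := by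
  obtain ⟨⟨x, s⟩, hxs⟩ := IsLocalizedModule.surj p.asIdeal.primeCompl
    (LocalizedModule.mkLinearMap p.asIdeal.primeCompl M) z
  have hsz : LocalizedModule.mkLinearMap p.asIdeal.primeCompl M x = (s : R) • z := hxs.symm
  have hres : LocalizedModule.mkLinearMap p.asIdeal.primeCompl M x ∈
      residual (IsLocalRing.maximalIdeal (Localization.AtPrime p.asIdeal))
        (N.localized p.asIdeal.primeCompl) := by
    rw [hsz]
    exact Submodule.smul_of_tower_mem _ _ hz
  rw [smul_mem_residual_maximalIdeal] at hres
  obtain ⟨T, hT⟩ := IsNoetherian.noetherian p.asIdeal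
  choose! t ht using hres
  let u : p.asIdeal.primeCompl := ∏ r ∈ T, t r
  have hu : p.asIdeal ≤ N.comap (LinearMap.toSpanSingleton R M (u • x)) := by
    refine hT.ge.trans (Submodule.span_le.2 fun r hr => ?_)
    have hrp : r ∈ p.asIdeal := hT.le (Submodule.subset_span hr)
    change r • u • x ∈ N
    obtain ⟨w, hw⟩ : t r ∣ u := Finset.dvd_prod_of_mem t hr
    rw [hw, mul_comm, mul_smul, smul_comm r, smul_comm r]
    exact N.smul_of_tower_mem w (ht r hrp)
  refine ⟨u • x, u * s, fun r => ⟨fun hr => hu hr, fun hr => ?_⟩, ?_⟩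
  · by_contra hrp
    apply hzN
    have h : LocalizedModule.mkLinearMap p.asIdeal.primeCompl M x ∈
        N.localized p.asIdeal.primeCompl :=
      mkLinearMap_mem_localized.2 ⟨⟨r, hrp⟩ * u, by rwa [mul_smul]⟩
    rw [hsz, ← algebraMap_smul (Localization.AtPrime p.asIdeal)] at h
    have hunit := IsLocalization.map_units (Localization.AtPrime p.asIdeal) s
    exact (Submodule.smul_mem_iff_of_isUnit _ hunit).1 h
  · rw [LinearMap.map_smul_of_tower, hsz, Submonoid.coe_mul, mul_smul]
    rfl

theorem mem_associatedPrimes_of_primeSocleLen_ne_zero [IsNoetherianRing R] {N : Submodule R M}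
    (h : primeSocleLen p N ≠ 0) : p.asIdeal ∈ associatedPrimes R (M ⧸ N) := by
  rw [primeSocleLen, socleLen, Ne, relLen_eq_zero, SetLike.not_le_iff_exists] at h
  obtain ⟨z, hz, hzN⟩ := h
  obtain ⟨y, -, hy, -⟩ := exists_annihilatorMod p hz hzN
  exact mem_associatedPrimes_quotient.2 ⟨p.2, y, hy⟩

end PrimeSocle

/-! ### The index of reducibility as a sum of socle lengths. -/

section Irreducible

variable {R : Type*} [CommRing R] {M : Type*} [AddCommGroup M] [Module R M]
  {Q : Submodule R M}

/-- For irreducible `Q`, the strictly larger submodules `Q + R x` and `Q + R y` must meet outside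
`Q`: modulo `Q`, any two nonzero elements have a common nonzero multiple. -/
theorem exists_smul_sub_smul_mem (hQ : InfIrred Q) {x y : M} (hx : x ∉ Q) (hy : y ∉ Q) :
    ∃ a b : R, a • x ∉ Q ∧ a • x - b • y ∈ Q := by
  by_contra! h
  have : (Q ⊔ Submodule.span R {x}) ⊓ (Q ⊔ Submodule.span R {y}) = Q := by
    refine le_antisymm ?_ (le_inf le_sup_left le_sup_left)
    rintro z ⟨hz₁, hz₂⟩
    obtain ⟨q, hq, w, hw, rfl⟩ := Submodule.mem_sup.1 hz₁
    obtain ⟨q', hq', w', hw', hz⟩ := Submodule.mem_sup.1 hz₂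
    obtain ⟨a, rfl⟩ := Submodule.mem_span_singleton.1 hw
    obtain ⟨b, rfl⟩ := Submodule.mem_span_singleton.1 hw'
    by_contra hq2
    refine h a b (fun h => hq2 (Q.add_mem hq h)) ?_
    have : a • x - b • y = q' - q := by
      rw [sub_eq_sub_iff_add_eq_add, add_comm, ← hz, ]
    rw [this]
    exact Q.sub_mem hq' hq
  rcases hQ.2 this with h | h
  · exact hx (h ▸ Submodule.mem_sup_right (Submodule.mem_span_singleton_self x))
  · exact hy (h ▸ Submodule.mem_sup_right (Submodule.mem_span_singleton_self y))

theorem AnnihilatorMod.notMem {p : Ideal R} [p.IsPrime] {x : M} (hx : AnnihilatorMod Q p x) :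
    x ∉ Q := fun h => (p.ne_top_iff_one.1 Ideal.IsPrime.ne_top') ((hx 1).2 (by rwa [one_smul]))

/-- A common nonzero multiple of `x` and `y` modulo `Q` has annihilator `p` as a multiple of `x` and
`q` as a multiple of `y`. -/
theorem AnnihilatorMod.unique (hQ : InfIrred Q) {p q : Ideal R} [hp : p.IsPrime] [hq : q.IsPrime]
    {x y : M} (hx : AnnihilatorMod Q p x) (hy : AnnihilatorMod Q q y) : p = q := by
  obtain ⟨a, b, ha, hab⟩ := exists_smul_sub_smul_mem hQ hx.notMem hy.notMem
  have hmem : ∀ r : R, r • a • x ∈ Q ↔ r • b • y ∈ Q := fun r => by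
    have := Q.smul_mem r hab
    rw [smul_sub] at this
    exact ⟨fun h => by simpa using Q.sub_mem h this, fun h => by simpa using Q.add_mem this h⟩
  have hap : a ∉ p := fun h => ha ((hx a).1 h)
  have hbq : b ∉ q := fun h => ha (by simpa using (hmem 1).2 (by simpa using (hy b).1 h))
  ext r
  have h₁ : r ∈ p ↔ r * a ∈ p := (hp.mul_mem_iff_mem_or_mem.trans (or_iff_left hap)).symm
  have h₂ : r ∈ q ↔ r * b ∈ q := (hq.mul_mem_iff_mem_or_mem.trans (or_iff_left hbq)).symm
  rw [h₁, h₂, hx, hy, mul_smul, mul_smul, hmem]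

variable [IsNoetherianRing R]

/-- Two socle elements lift to elements with annihilator `p` modulo `Q`, which have a common nonzero
multiple. Its coefficient on the first lies outside `p`, hence is a unit in `R_p`, so one socle
element generates. -/
theorem primeSocleLen_le_one (hQ : InfIrred Q) (p : PrimeSpectrum R) : primeSocleLen p Q ≤ 1 := by
  by_cases h : residual (IsLocalRing.maximalIdeal (Localization.AtPrime p.asIdeal))
      (Q.localized p.asIdeal.primeCompl) ≤ Q.localized p.asIdeal.primeCompl
  · rw [primeSocleLen, socleLen, relLen_eq_zero.2 h]
    exact bot_le
  obtain ⟨z₀, hz₀, hz₀Q⟩ := SetLike.not_le_iff_exists.1 h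
  obtain ⟨y₀, s₀, hy₀, hyz₀⟩ := exists_annihilatorMod p hz₀ hz₀Q
  have hle : residual (IsLocalRing.maximalIdeal (Localization.AtPrime p.asIdeal))
      (Q.localized p.asIdeal.primeCompl) ≤
        Q.localized p.asIdeal.primeCompl ⊔ Submodule.span _ {z₀} := by
    intro z hz
    by_cases hzQ : z ∈ Q.localized p.asIdeal.primeCompl
    · exact Submodule.mem_sup_left hzQ
    obtain ⟨y, s, hy, hyz⟩ := exists_annihilatorMod p hz hzQ
    obtain ⟨a, b, ha, hab⟩ := exists_smul_sub_smul_mem hQ hy.notMem hy₀.notMem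
    have hap : a ∈ p.asIdeal.primeCompl := fun h => ha ((hy a).1 h)
    have h₁ : LocalizedModule.mkLinearMap p.asIdeal.primeCompl M (a • y - b • y₀) ∈
        Q.localized p.asIdeal.primeCompl := mkLinearMap_mem_localized.2 ⟨1, by simpa using hab⟩
    rw [map_sub, map_smul, map_smul, hyz, hyz₀, smul_smul, smul_smul] at h₁
    have h₂ : (b * (s₀ : R)) • z₀ ∈ Q.localized p.asIdeal.primeCompl ⊔
        Submodule.span (Localization.AtPrime p.asIdeal) {z₀} :=
      Submodule.smul_of_tower_mem _ _
        (Submodule.mem_sup_right (Submodule.mem_span_singleton_self z₀))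
    have h₃ := Submodule.add_mem _ (Submodule.mem_sup_left h₁) h₂
    rw [sub_add_cancel, ← algebraMap_smul (Localization.AtPrime p.asIdeal)] at h₃
    have hunit := IsLocalization.map_units (Localization.AtPrime p.asIdeal)
      (⟨a, hap⟩ * s : p.asIdeal.primeCompl)
    exact (Submodule.smul_mem_iff_of_isUnit _ hunit).1 h₃
  refine (relLen_mono_right _ hle).trans ?_
  rw [relLen_sup_left]
  exact relLen_span_singleton_le_one (IsLocalRing.maximalIdeal.isMaximal _) hz₀

theorem primeSocleLen_eq_zero (hQ : InfIrred Q) {q : Ideal R} [q.IsPrime] {x : M}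
    (hx : AnnihilatorMod Q q x) {p : PrimeSpectrum R} (hpq : p.asIdeal ≠ q) :
    primeSocleLen p Q = 0 := by
  by_contra h
  obtain ⟨hp, y, hy⟩ := mem_associatedPrimes_quotient.1
    (mem_associatedPrimes_of_primeSocleLen_ne_zero p h)
  exact hpq (AnnihilatorMod.unique hQ hy hx)

theorem exists_annihilatorMod_of_lt {N L : Submodule R M} (h : ¬ L ≤ N) :
    ∃ (p : PrimeSpectrum R) (x : M), x ∈ L ∧ AnnihilatorMod N p.asIdeal x := by
  obtain ⟨w, hwL, hwN⟩ := SetLike.not_le_iff_exists.1 h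
  obtain ⟨P, hP, -⟩ := exists_le_isAssociatedPrime_of_isNoetherianRing R
    (⟨N.mkQ w, w, hwL, rfl⟩ : L.map N.mkQ) (fun h => hwN (by simpa using congrArg Subtype.val h))
  rw [isAssociatedPrime_iff] at hP
  obtain ⟨hP, ⟨_, x, hx, rfl⟩, hPx⟩ := hP
  refine ⟨⟨P, hP⟩, x, hx, fun r => ?_⟩
  change r ∈ P ↔ _
  rw [hPx, Submodule.mem_colon_singleton, Submodule.mem_bot, ← Subtype.coe_inj]
  change r • N.mkQ x = 0 ↔ _
  rw [← map_smul, Submodule.mkQ_apply, Submodule.Quotient.mk_eq_zero]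

/-- Irredundancy gives for each component `Q` an element `x Q` in all the other components whose
annihilator modulo `N` is a prime `q Q`; this is also its annihilator modulo `Q`. Hence `Q`
contributes at most one to the socle at `q Q` and nothing elsewhere, while the `x Q` with `q Q = p`
are independent socle elements at `p`. So the socle length at `p` counts the components with prime
`p`. -/
theorem card_irredundantDecomposition {N : Submodule R M} {s : Finset (Submodule R M)}
    (hs : IsIrredundantDecomposition N s) (F : Finset (PrimeSpectrum R))
    (hF : ∀ p : PrimeSpectrum R, p.asIdeal ∈ associatedPrimes R (M ⧸ N) → p ∈ F) :
    s.card = ∑ p ∈ F, (primeSocleLen p N).toNat := by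
  classical
  obtain ⟨hirr, hinf, hmin⟩ := hs
  rcases s.eq_empty_or_nonempty with rfl | hne
  · rw [Finset.inf_empty] at hinf
    simp [← hinf, primeSocleLen_top]
  have hex : ∀ Q ∈ s, ∃ (p : PrimeSpectrum R) (x : M),
      x ∈ (s.erase Q).inf id ∧ AnnihilatorMod N p.asIdeal x := fun Q hQ => by
    refine exists_annihilatorMod_of_lt fun hle => hmin _ (Finset.erase_ssubset hQ) ?_
    exact le_antisymm hle (hinf ▸ Finset.inf_mono (Finset.erase_subset Q s))
  have : Nonempty (PrimeSpectrum R) := ⟨(hex _ hne.choose_spec).choose⟩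
  choose! q x hxL hxN using hex
  have hNinf : ∀ Q ∈ s, N = Q ⊓ (s.erase Q).inf id := fun Q hQ => by
    rw [← hinf, ← Finset.insert_erase hQ, Finset.inf_insert, Finset.insert_erase hQ]
    rfl
  have hxQ : ∀ Q ∈ s, AnnihilatorMod Q (q Q).asIdeal (x Q) := fun Q hQ r => by
    rw [hxN Q hQ r, hNinf Q hQ, Submodule.mem_inf]
    exact and_iff_left (Submodule.smul_mem _ _ (hxL Q hQ))
  have hqF : ∀ Q ∈ s, q Q ∈ F := fun Q hQ =>
    hF _ (mem_associatedPrimes_quotient.2 ⟨(q Q).2, _, hxN Q hQ⟩)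
  rw [Finset.card_eq_sum_card_fiberwise hqF]
  refine Finset.sum_congr rfl fun p _ => ?_
  suffices h : primeSocleLen p N = ((s.filter fun Q => q Q = p).card : ℕ∞) by
    rw [h, ENat.toNat_natCast]
  refine le_antisymm ?_ ?_
  · rw [← hinf]
    refine (primeSocleLen_finset_inf_le p s).trans ?_
    rw [Finset.card_filter]
    push_cast
    refine Finset.sum_le_sum fun Q hQ => ?_
    split_ifs with h
    · exact primeSocleLen_le_one (hirr Q hQ) p
    · rw [primeSocleLen_eq_zero (hirr Q hQ) (hxQ Q hQ) fun h' => h (PrimeSpectrum.ext h'.symm)]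
  · rw [← Fintype.card_coe]
    have hmem : ∀ Q : {Q // Q ∈ s.filter fun Q => q Q = p}, (Q : Submodule R M) ∈ s ∧ q Q = p :=
      fun Q => Finset.mem_filter.1 Q.2
    refine card_le_primeSocleLen p (fun Q : {Q // Q ∈ s.filter fun Q => q Q = p} => x Q)
      (fun Q r hr => ?_) fun c hc Q => ?_
    · exact (hxN Q (hmem Q).1 r).1 ((hmem Q).2.symm ▸ hr)
    · have h₁ : ∑ Q', c Q' • x Q' ∈ (Q : Submodule R M) :=
        (hNinf Q (hmem Q).1 ▸ inf_le_left : N ≤ Q) hc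
      rw [← Finset.add_sum_erase _ _ (Finset.mem_univ Q)] at h₁
      -- Independence: every other `x Q'` lies in `Q`, so a relation modulo `N` leaves only the term
      -- of `Q` modulo `Q`.
      have h₂ : ∑ Q' ∈ Finset.univ.erase Q, c Q' • x Q' ∈ (Q : Submodule R M) := by
        refine Submodule.sum_mem _ fun Q' hQ' => Submodule.smul_mem _ _ ?_
        have hne : (Q : Submodule R M) ≠ Q' := fun h =>
          (Finset.mem_erase.1 hQ').1 (Subtype.ext h.symm)
        exact (Finset.inf_le (Finset.mem_erase.2 ⟨hne, (hmem Q).1⟩) :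
          (s.erase Q').inf id ≤ Q) (hxL Q' (hmem Q').1)
      have h₃ := (Submodule.add_mem_iff_left _ h₂).1 h₁
      have := (hxQ Q (hmem Q).1 (c Q)).2 h₃
      rwa [(hmem Q).2] at this

/-- The index of reducibility is the sum of the socle lengths at the associated primes. -/
theorem ir_eq_sum [IsNoetherian R M] (N : Submodule R M) (F : Finset (PrimeSpectrum R))
    (hF : ∀ p : PrimeSpectrum R, p.asIdeal ∈ associatedPrimes R (M ⧸ N) → p ∈ F) :
    ir N = ∑ p ∈ F, (primeSocleLen p N).toNat := by
  obtain ⟨s, hs⟩ := exists_isIrredundantDecomposition N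
  have : {k : ℕ | ∃ s : Finset (Submodule R M), IsIrredundantDecomposition N s ∧ s.card = k} =
      {∑ p ∈ F, (primeSocleLen p N).toNat} := by
    ext k
    constructor
    · rintro ⟨s, hs, rfl⟩
      exact card_irredundantDecomposition hs F hF
    · rintro rfl
      exact ⟨s, hs, card_irredundantDecomposition hs F hF⟩
  rw [ir, this, csInf_singleton]

end Irreducible
end IrPoly

namespace IrPoly

/-! ### Homogeneous systems of parameters. -/

section Graded

variable {A : Type*} [CommRing A] {σ : Type*} [SetLike σ A] [AddSubgroupClass σ A] (𝒜 : ℕ → σ) [GradedRing 𝒜]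

/-- The homogeneous core of `P` is a prime still containing `b`, so minimality makes it equal to
`P`. -/
theorem isHomogeneous_of_mem_minimalPrimes {b P : Ideal A} (hb : b.IsHomogeneous 𝒜)
    (hP : P ∈ b.minimalPrimes) : P.IsHomogeneous 𝒜 := by
  have hprime : P.IsPrime := hP.1.1
  have hle : b ≤ (P.homogeneousCore 𝒜).toIdeal := by
    rw [← hb.toIdeal_homogeneousCore_eq_self]
    exact Ideal.homogeneousCore_mono 𝒜 hP.1.2
  have h := hP.2 ⟨hprime.homogeneousCore, hle⟩ (Ideal.toIdeal_homogeneousCore_le 𝒜 P)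
  rw [le_antisymm h (Ideal.toIdeal_homogeneousCore_le 𝒜 P)]
  exact (P.homogeneousCore 𝒜).isHomogeneous

theorem exists_homogeneous_mem_notMem {c P : Ideal A} (hc : c.IsHomogeneous 𝒜) (h : ¬ c ≤ P) :
    ∃ n, ∃ z ∈ 𝒜 n, z ∈ c ∧ z ∉ P := by
  classical
  obtain ⟨x, hxc, hxP⟩ := SetLike.not_le_iff_exists.1 h
  by_contra! hall
  refine hxP ?_
  rw [← DirectSum.sum_support_decompose 𝒜 x]
  exact Ideal.sum_mem _ fun i _ => hall i _ (SetLike.coe_mem _) (hc i hxc)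

theorem eq_zero_of_mem_irrelevant {z : A} (hz : z ∈ 𝒜 0)
    (h : z ∈ (HomogeneousIdeal.irrelevant 𝒜).toIdeal) : z = 0 := by
  have : (DirectSum.decompose 𝒜 z 0 : A) = 0 := h
  rwa [DirectSum.decompose_of_mem_same 𝒜 hz] at this

/-- Homogeneous prime avoidance. -/
theorem exists_homogeneous_notMem (T : Finset (Ideal A))
    (hprime : ∀ P ∈ T, P.IsPrime) (hhom : ∀ P ∈ T, P.IsHomogeneous 𝒜)
    (hirr : ∀ P ∈ T, ¬ (HomogeneousIdeal.irrelevant 𝒜).toIdeal ≤ P)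
    (hinc : ∀ P ∈ T, ∀ Q ∈ T, P ≤ Q → P = Q) :
    ∃ d, 0 < d ∧ ∃ y ∈ 𝒜 d, ∀ P ∈ T, y ∉ P := by
  classical
  induction T using Finset.induction_on with
  | empty => exact ⟨1, one_pos, 0, zero_mem _, by simp⟩
  | insert P T hPT ih =>
    have hPins := Finset.mem_insert_self P T
    have hins : ∀ Q ∈ T, Q ∈ insert P T := fun Q hQ => Finset.mem_insert_of_mem hQ
    obtain ⟨d, hd, y, hyd, hy⟩ := ih (fun Q hQ => hprime Q (hins Q hQ))
      (fun Q hQ => hhom Q (hins Q hQ)) (fun Q hQ => hirr Q (hins Q hQ))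
      (fun Q hQ Q' hQ' => hinc Q (hins Q hQ) Q' (hins Q' hQ'))
    by_cases hyP : y ∈ P
    swap
    · exact ⟨d, hd, y, hyd, fun Q hQ => (Finset.mem_insert.1 hQ).elim (fun h => h ▸ hyP) (hy Q)⟩
    have hPprime := hprime P hPins
    have hc : ((HomogeneousIdeal.irrelevant 𝒜).toIdeal ⊓ T.inf id).IsHomogeneous 𝒜 := by
      refine (HomogeneousIdeal.isHomogeneous _).inf ?_
      rw [Finset.inf_eq_iInf]
      exact Ideal.IsHomogeneous.iInf₂ fun Q hQ => hhom Q (hins Q hQ)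
    have hnle : ¬ (HomogeneousIdeal.irrelevant 𝒜).toIdeal ⊓ T.inf id ≤ P := by
      rw [hPprime.inf_le, not_or]
      refine ⟨hirr P hPins, fun h => ?_⟩
      obtain ⟨Q, hQ, hQP⟩ := (hPprime.inf_le').1 h
      exact hPT (hinc Q (hins Q hQ) P hPins hQP ▸ hQ)
    obtain ⟨e, z, hze, ⟨hzirr, hzT⟩, hzP⟩ := exists_homogeneous_mem_notMem 𝒜 hc hnle
    have he : 0 < e := by
      rcases Nat.eq_zero_or_pos e with rfl | he
      · exact absurd (eq_zero_of_mem_irrelevant 𝒜 hze hzirr ▸ P.zero_mem) hzP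
      · exact he
    -- The powers equalize degrees. Here `y` lies in `P` but in no member of `T`, and `z` lies in
    -- every member of `T` but not in `P`, so the sum avoids all of them.
    have hmem : y ^ e + z ^ d ∈ 𝒜 (e * d) := by
      refine add_mem ?_ ?_
      · simpa using SetLike.pow_mem_graded e hyd
      · rw [mul_comm]
        simpa using SetLike.pow_mem_graded d hze
    refine ⟨e * d, Nat.mul_pos he hd, _, hmem, fun Q hQ hmemQ => ?_⟩
    rcases Finset.mem_insert.1 hQ with rfl | hQ
    · have := (Ideal.add_mem_iff_right _ (Ideal.pow_mem_of_mem _ hyP e he)).1 hmemQ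
      exact hzP (hPprime.mem_of_pow_mem d this)
    · have hzQ : z ∈ Q := (Finset.inf_le hQ : T.inf id ≤ Q) hzT
      have := (Ideal.add_mem_iff_left _ (Ideal.pow_mem_of_mem _ hzQ d hd)).1 hmemQ
      exact hy Q hQ ((hprime Q (hins Q hQ)).mem_of_pow_mem e this)

/-- Otherwise the degree-zero component of `1 = x + y`, with `y` irrelevant, would come from `x` and
lie in `P`. -/
theorem sup_irrelevant_ne_top {P : Ideal A} (hP : P.IsHomogeneous 𝒜) (hne : P ≠ ⊤) :
    P ⊔ (HomogeneousIdeal.irrelevant 𝒜).toIdeal ≠ ⊤ := by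
  rw [Ne, Ideal.eq_top_iff_one, Submodule.mem_sup]
  rintro ⟨x, hx, y, hy, hxy⟩
  have h₁ : (DirectSum.decompose 𝒜 y 0 : A) = 0 := hy
  have h₂ : (DirectSum.decompose 𝒜 (x + y) 0 : A) = 1 := by
    rw [hxy, DirectSum.decompose_of_mem_same 𝒜 SetLike.GradedOne.one_mem]
  rw [DirectSum.decompose_add, DirectSum.add_apply, AddMemClass.coe_add, h₁, add_zero] at h₂
  exact hne ((Ideal.eq_top_iff_one P).2 (h₂ ▸ hP 0 hx))

/-- Existence of a homogeneous system of parameters, up to radical. -/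
theorem exists_homogeneous_parameters [IsNoetherianRing A] (d : ℕ) : ∀ (b : Ideal A),
    b.IsHomogeneous 𝒜 →
    (∀ P : Ideal A, P.IsPrime → b ≤ P → (HomogeneousIdeal.irrelevant 𝒜).toIdeal ≤ P →
      P.IsMaximal) →
    (∀ s : LTSeries (PrimeSpectrum A), b ≤ s.head.asIdeal → s.length ≤ d) →
    ∃ e, 0 < e ∧ ∃ y : Fin d → A, (∀ i, y i ∈ 𝒜 e) ∧
      (HomogeneousIdeal.irrelevant 𝒜).toIdeal ≤ (b ⊔ Ideal.span (Set.range y)).radical := by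
  induction d with
  | zero =>
    intro b hb hmax hlen
    refine ⟨1, one_pos, Fin.elim0, fun i => i.elim0, ?_⟩
    refine le_trans ?_ (Ideal.radical_mono le_sup_left)
    rw [← Ideal.sInf_minimalPrimes]
    refine le_sInf fun P hP => ?_
    have hprime : P.IsPrime := hP.1.1
    obtain ⟨Q, hQ, hle⟩ := Ideal.exists_le_maximal _
      (sup_irrelevant_ne_top 𝒜 (isHomogeneous_of_mem_minimalPrimes 𝒜 hb hP) hprime.ne_top)
    -- Chains above `b` have length zero, so a minimal prime equals the maximal ideal that contains
    -- it and the irrelevant ideal.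
    have hPQ : P = Q := by
      by_contra hne
      have hlt : (⟨P, hprime⟩ : PrimeSpectrum A) < ⟨Q, hQ.isPrime⟩ :=
        lt_of_le_of_ne (le_sup_left.trans hle : P ≤ Q) fun h => hne (congrArg PrimeSpectrum.asIdeal h)
      let s : LTSeries (PrimeSpectrum A) :=
        (RelSeries.singleton _ ⟨Q, hQ.isPrime⟩ : LTSeries (PrimeSpectrum A)).cons ⟨P, hprime⟩ hlt
      have : s.length ≤ 0 := hlen s hP.1.2
      exact absurd (show 0 + 0 + 1 ≤ 0 from this) (by simp)
    rw [hPQ]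
    exact le_sup_right.trans hle
  | succ d ih =>
    intro b hb hmax hlen
    classical
    have hfin : b.minimalPrimes.Finite := b.finite_minimalPrimes_of_isNoetherianRing
    obtain ⟨T, hT'⟩ : ∃ T : Finset (Ideal A), ∀ P, P ∈ T ↔ P ∈ b.minimalPrimes ∧
        ¬ (HomogeneousIdeal.irrelevant 𝒜).toIdeal ≤ P :=
      ⟨hfin.toFinset.filter fun P => ¬ (HomogeneousIdeal.irrelevant 𝒜).toIdeal ≤ P, fun P => by
        rw [Finset.mem_filter, Set.Finite.mem_toFinset]⟩
    have hT := fun P => (hT' P).1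
    obtain ⟨e₀, he₀, y₀, hy₀, hy₀T⟩ := exists_homogeneous_notMem 𝒜 T (fun P hP => (hT P hP).1.1.1)
      (fun P hP => isHomogeneous_of_mem_minimalPrimes 𝒜 hb (hT P hP).1) (fun P hP => (hT P hP).2)
      (fun P hP Q hQ h => le_antisymm h ((hT Q hQ).1.2 (hT P hP).1.1 h))
    obtain ⟨e₁, he₁, y₁, hy₁, hrad⟩ := ih (b ⊔ Ideal.span {y₀})
      (hb.sup (Ideal.homogeneous_span 𝒜 _ (by rintro _ rfl; exact ⟨e₀, hy₀⟩)))
      (fun P hP hle => hmax P hP (le_sup_left.trans hle))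
      (fun s hs => by
        obtain ⟨Q, hQ, hQs⟩ := Ideal.exists_minimalPrimes_le (le_sup_left.trans hs)
        have hQprime : Q.IsPrime := hQ.1.1
        -- A minimal prime of `b` containing the irrelevant ideal is maximal, so chains above it are
        -- trivial. Any other one misses `y₀` and can be prepended to a chain above `b + (y₀)`.
        by_cases hirr : (HomogeneousIdeal.irrelevant 𝒜).toIdeal ≤ Q
        · have hQmax := hmax Q hQprime hQ.1.2 hirr
          by_contra! hpos
          have hlt : s.head < s.last := s.strictMono (Fin.lt_def.2 (show 0 < s.length by lia))
          have h₁ := hQmax.eq_of_le s.last.2.ne_top (hQs.trans hlt.le)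
          exact hlt.not_ge (h₁ ▸ hQs : s.last.asIdeal ≤ s.head.asIdeal)
        · have hy₀Q : y₀ ∉ Q := hy₀T Q ((hT' Q).2 ⟨hQ, hirr⟩)
          have hy₀s : y₀ ∈ s.head.asIdeal :=
            hs (Ideal.mem_sup_right (Ideal.mem_span_singleton_self y₀))
          have hlt : (⟨Q, hQprime⟩ : PrimeSpectrum A) < s.head :=
            lt_of_le_of_ne hQs fun h => hy₀Q (h ▸ hy₀s : y₀ ∈ (⟨Q, hQprime⟩ : PrimeSpectrum A).asIdeal)
          have := hlen (s.cons ⟨Q, hQprime⟩ hlt) hQ.1.2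
          simpa using this)
    let y : Fin (d + 1) → A := Fin.cons (y₀ ^ e₁) fun i => y₁ i ^ e₀
    refine ⟨e₀ * e₁, Nat.mul_pos he₀ he₁, y, fun i => ?_, ?_⟩
    · refine Fin.cases ?_ (fun i => ?_) i
      · rw [mul_comm]
        simpa [y] using SetLike.pow_mem_graded e₁ hy₀
      · simpa [y] using SetLike.pow_mem_graded e₀ (hy₁ i)
    · refine hrad.trans ?_
      rw [Ideal.radical_le_radical_iff]
      have hy : ∀ i, y i ∈ b ⊔ Ideal.span (Set.range y) := fun i =>
        Ideal.mem_sup_right (Ideal.subset_span ⟨i, rfl⟩)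
      refine sup_le (sup_le (le_sup_left.trans Ideal.le_radical) ?_) ?_
      · rw [Ideal.span_singleton_le_iff_mem]
        exact ⟨e₁, hy 0⟩
      · rw [Ideal.span_le]
        rintro _ ⟨i, rfl⟩
        exact ⟨e₀, hy i.succ⟩

end Graded
end IrPoly

namespace IrPoly

/-! ### Reductions from parameters of the fibre cone. -/

section ReesPresentation

open MvPolynomial

variable {R : Type*} [CommRing R] {M : Type*} [AddCommGroup M] [Module R M] {r : ℕ} (a : Fin r → R)

/-- The homomorphism from a polynomial ring onto the Rees algebra of `(a₁, …, aᵣ)`. -/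
noncomputable def reesHom : MvPolynomial (Fin r) R →ₐ[R] Polynomial R :=
  aeval fun i => Polynomial.monomial 1 (a i)

theorem reesHom_monomial (d : Fin r →₀ ℕ) (c : R) :
    reesHom a (monomial d c) = Polynomial.monomial d.degree (eval a (monomial d c)) := by
  rw [reesHom, aeval_monomial, eval_monomial, Finsupp.prod, Finsupp.prod, Finsupp.degree_apply]
  simp only [Polynomial.monomial_pow, one_mul]
  rw [Polynomial.algebraMap_eq, ← Polynomial.C_mul_monomial]
  congr 1
  generalize d.support = s
  classical
  induction s using Finset.induction_on with
  | empty => simp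
  | insert i s hi ih =>
    rw [Finset.prod_insert hi, Finset.prod_insert hi, Finset.sum_insert hi, ih,
      Polynomial.monomial_mul_monomial]

theorem coeff_reesHom (F : MvPolynomial (Fin r) R) (n : ℕ) :
    (reesHom a F).coeff n = eval a (homogeneousComponent n F) := by
  induction F using MvPolynomial.induction_on' with
  | monomial d c =>
    rw [reesHom_monomial, Polynomial.coeff_monomial,
      homogeneousComponent_of_mem (isHomogeneous_monomial c rfl)]
    by_cases h : d.degree = n
    · simp [h]
    · simp [h, Ne.symm h]
  | add p q hp hq => simp [hp, hq]

theorem coeff_reesHom_mem (F : MvPolynomial (Fin r) R) (n : ℕ) :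
    (reesHom a F).coeff n ∈ Ideal.span (Set.range a) ^ n := by
  rw [Ideal.mem_span_pow_iff_exists_isHomogeneous]
  exact ⟨_, homogeneousComponent_isHomogeneous n F, (coeff_reesHom a F n).symm⟩

theorem pow_smul_le_of_smul_le {I : Ideal R} {D : ℕ → Submodule R M}
    (hD : ∀ n, I • D n ≤ D (n + 1)) (i j : ℕ) : I ^ i • D j ≤ D (i + j) := by
  induction i with
  | zero => simp
  | succ i ih =>
    rw [pow_succ', mul_smul, add_right_comm]
    exact (Submodule.smul_mono le_rfl ih).trans (hD _)

/-- The ideal of polynomials whose homogeneous components of degree `n`, evaluated at `a`, carry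
`M` into `D n`. -/
noncomputable def gradedAnn (D : ℕ → Submodule R M)
    (hD : ∀ n, Ideal.span (Set.range a) • D n ≤ D (n + 1)) : Ideal (MvPolynomial (Fin r) R) where
  carrier := {F | ∀ n x, (reesHom a F).coeff n • x ∈ D n}
  add_mem' hF hG n x := by
    rw [map_add, Polynomial.coeff_add, add_smul]
    exact Submodule.add_mem _ (hF n x) (hG n x)
  zero_mem' n x := by simp
  smul_mem' G F hF n x := by
    rw [smul_eq_mul, map_mul, Polynomial.coeff_mul, Finset.sum_smul]
    refine Submodule.sum_mem _ fun ij hij => ?_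
    rw [← Finset.HasAntidiagonal.mem_antidiagonal.1 hij, mul_smul]
    exact pow_smul_le_of_smul_le hD _ _
      (Submodule.smul_mem_smul (coeff_reesHom_mem a G ij.1) (hF ij.2 x))

variable {a} {D : ℕ → Submodule R M} {hD : ∀ n, Ideal.span (Set.range a) • D n ≤ D (n + 1)}

theorem mem_gradedAnn {F : MvPolynomial (Fin r) R} :
    F ∈ gradedAnn a D hD ↔ ∀ n x, (reesHom a F).coeff n • x ∈ D n := Iff.rfl

theorem mem_gradedAnn_of_isHomogeneous {F : MvPolynomial (Fin r) R} {k : ℕ} (hF : F.IsHomogeneous k) :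
    F ∈ gradedAnn a D hD ↔ ∀ x, eval a F • x ∈ D k := by
  rw [mem_gradedAnn]
  have h : ∀ n, (reesHom a F).coeff n = if n = k then eval a F else 0 := fun n => by
    rw [coeff_reesHom, homogeneousComponent_of_mem hF]
    split_ifs <;> simp
  constructor
  · intro hF x
    simpa [h] using hF k x
  · intro hF n x
    rw [h]
    split_ifs with hn
    · exact hn ▸ hF x
    · simp

attribute [local instance] MvPolynomial.gradedAlgebra

theorem isHomogeneous_gradedAnn :
    (gradedAnn a D hD).IsHomogeneous (homogeneousSubmodule (Fin r) R) := by
  intro n F hF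
  have h : ((DirectSum.decompose (homogeneousSubmodule (Fin r) R) F) n : MvPolynomial (Fin r) R) =
    homogeneousComponent n F := decomposition.decompose'_apply F n
  rw [h, mem_gradedAnn_of_isHomogeneous (homogeneousComponent_isHomogeneous n F)]
  intro x
  rw [← coeff_reesHom]
  exact hF n x

theorem idealOfVars_le_irrelevant : idealOfVars (Fin r) R ≤
    (HomogeneousIdeal.irrelevant (homogeneousSubmodule (Fin r) R)).toIdeal := by
  rw [idealOfVars, Ideal.span_le]
  rintro _ ⟨i, rfl⟩
  exact HomogeneousIdeal.mem_irrelevant_of_mem _ one_pos (isHomogeneous_X R i)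

/-- Modulo `P` every polynomial equals its constant term, and constants outside `P` are units of the
local ring `R`. -/
theorem isMaximal_of_idealOfVars_le [IsLocalRing R] {P : Ideal (MvPolynomial (Fin r) R)}
    (hP : P.IsPrime) (hm : (IsLocalRing.maximalIdeal R).map C ≤ P)
    (hirr : idealOfVars (Fin r) R ≤ P) : P.IsMaximal := by
  rw [Ideal.isMaximal_iff]
  refine ⟨fun h => hP.ne_top (P.eq_top_iff_one.2 h), fun J F hPJ hFP hFJ => ?_⟩
  have hdiff : F - C (constantCoeff F) ∈ P := by
    refine hirr ?_
    have := (mem_pow_idealOfVars_iff' 1 (F - C (constantCoeff F))).2 fun x hx => by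
      have hx0 : x = 0 := by
        exact (Finsupp.degree_eq_zero_iff x).1 (by lia)
      simp [hx0, constantCoeff_eq]
    simpa using this
  have hcP : C (constantCoeff F) ∉ P := fun h => hFP (by simpa using P.add_mem hdiff h)
  have hunit : IsUnit (constantCoeff F) := by
    by_contra h
    exact hcP (hm (Ideal.mem_map_of_mem C ((IsLocalRing.mem_maximalIdeal _).2 h)))
  have hcJ : C (constantCoeff F) ∈ J := by
    simpa using J.sub_mem hFJ (hPJ hdiff)
  have := J.eq_top_of_isUnit_mem hcJ (hunit.map C)
  rw [this]
  trivial

/-- If the fibre cone of `I` on `M` has dimension at most `d`, then some ideal `J` generated by `d`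
elements of a power `Iᵉ` satisfies `Iⁿ⁺ᵉ M = J Iⁿ M` for some `n`. -/
theorem exists_reduction_of_gradedAnn [IsLocalRing R] [IsNoetherianRing R] [Module.Finite R M]
    {I : Ideal R} (ha : Ideal.span (Set.range a) = I)
    (hD : ∀ n, Ideal.span (Set.range a) • (IsLocalRing.maximalIdeal R • I ^ n • (⊤ : Submodule R M)) ≤
      IsLocalRing.maximalIdeal R • I ^ (n + 1) • ⊤) {d : ℕ}
    (hlen : ∀ s : LTSeries (PrimeSpectrum (MvPolynomial (Fin r) R)),
      gradedAnn a (fun n => IsLocalRing.maximalIdeal R • I ^ n • (⊤ : Submodule R M)) hD ≤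
        s.head.asIdeal → s.length ≤ d) :
    ∃ e n₀ : ℕ, e ≠ 0 ∧ ∃ y : Fin d → R, (∀ i, y i ∈ I ^ e) ∧
      I ^ (n₀ + e) • (⊤ : Submodule R M) ≤ Ideal.span (Set.range y) • I ^ n₀ • ⊤ := by
  set m := IsLocalRing.maximalIdeal R with hm
  set b := gradedAnn a (fun n => m • I ^ n • (⊤ : Submodule R M)) hD with hb
  have hmb : m.map C ≤ b := by
    rw [Ideal.map_le_iff_le_comap]
    intro c hc
    rw [Ideal.mem_comap, hb, mem_gradedAnn_of_isHomogeneous (isHomogeneous_C _ c)]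
    intro x
    rw [eval_C, pow_zero, Ideal.one_eq_top, Submodule.top_smul]
    exact Submodule.smul_mem_smul hc trivial
  obtain ⟨e, he, Y, hY, hrad⟩ := exists_homogeneous_parameters (homogeneousSubmodule (Fin r) R) d b
    isHomogeneous_gradedAnn
    (fun P hP hbP hirr => isMaximal_of_idealOfVars_le hP (hmb.trans hbP)
      (idealOfVars_le_irrelevant.trans hirr)) hlen
  let y : Fin d → R := fun i => eval a (Y i)
  have hy : ∀ i, y i ∈ I ^ e := fun i => by
    rw [← ha, Ideal.mem_span_pow_iff_exists_isHomogeneous]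
    exact ⟨Y i, hY i, rfl⟩
  set J := Ideal.span (Set.range y) with hJ
  -- This enlarges `m Iⁿ M` by `J Iⁿ⁻ᵉ M`, so that the parameters `Y i`, of degree `e`, also lie in
  -- the associated ideal `gradedAnn a D' hD'`. Below degree `e` nothing is added.
  let D' : ℕ → Submodule R M := fun n =>
    m • I ^ n • ⊤ ⊔ if e ≤ n then J • I ^ (n - e) • ⊤ else ⊥
  have hD' : ∀ n, Ideal.span (Set.range a) • D' n ≤ D' (n + 1) := by
    intro n
    simp only [D']
    rw [Submodule.smul_sup]
    refine sup_le_sup (hD n) ?_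
    split_ifs with h₁ h₂ h₂
    · rw [ha, ← mul_smul, mul_comm, mul_smul, ← mul_smul I, ← pow_succ',
        show n - e + 1 = n + 1 - e by lia]
    · lia
    · simp
    · simp
  obtain ⟨N, hN⟩ := Ideal.exists_pow_le_of_le_radical_of_fg
    (idealOfVars_le_irrelevant.trans hrad) (IsNoetherian.noetherian (idealOfVars (Fin r) R))
  have hle : b ⊔ Ideal.span (Set.range Y) ≤ gradedAnn a D' hD' := by
    refine sup_le (fun F hF n x => Submodule.mem_sup_left (hF n x)) ?_
    rw [Ideal.span_le]
    rintro _ ⟨i, rfl⟩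
    rw [SetLike.mem_coe, mem_gradedAnn_of_isHomogeneous (hY i)]
    intro x
    refine Submodule.mem_sup_right ?_
    rw [if_pos le_rfl, Nat.sub_self, pow_zero, Ideal.one_eq_top, Submodule.top_smul]
    exact Submodule.smul_mem_smul (Ideal.subset_span ⟨i, rfl⟩) trivial
  refine ⟨e, N, he.ne', y, hy, ?_⟩
  -- All forms of degree at least `N` lie in the enlarged ideal. In degree `N + e` this reads
  -- `I^(N+e) M ⊆ m I^(N+e) M + J I^N M`, and Nakayama removes the first summand.
  have hpow : I ^ (N + e) • (⊤ : Submodule R M) ≤ D' (N + e) := by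
    refine Submodule.smul_le.2 fun c hc x _ => ?_
    rw [← ha, Ideal.mem_span_pow_iff_exists_isHomogeneous] at hc
    obtain ⟨F, hF, rfl⟩ := hc
    refine (mem_gradedAnn_of_isHomogeneous (hD := hD') hF).1 (hle (hN ?_)) x
    rw [mem_pow_idealOfVars_iff]
    intro z hz
    have : z.degree = N + e := by
      by_contra hne
      exact (mem_support_iff.1 hz) (hF.coeff_eq_zero hne)
    lia
  refine Submodule.le_of_le_smul_of_le_jacobson_bot (I := m) (IsNoetherian.noetherian _)
    (IsLocalRing.jacobson_eq_maximalIdeal ⊥ bot_ne_top).ge ?_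
  refine hpow.trans ?_
  simp only [D']
  rw [if_pos (by lia), Nat.add_sub_cancel, sup_comm]

end ReesPresentation
end IrPoly

namespace IrPoly

theorem map_smul_top_le {R S N : Type*} [CommRing R] [CommRing S] [AddCommGroup N] [Module S N]
    {f : R →+* S} {c : Ideal R} {L : Submodule S N} (h : ∀ x ∈ c, ∀ u : N, f x • u ∈ L) :
    c.map f • (⊤ : Submodule S N) ≤ L := by
  have hle : c.map f ≤ L.colon ⊤ := Ideal.map_le_iff_le_comap.2 fun x hx =>
    Submodule.mem_colon.2 fun u _ => h x hx u
  exact Submodule.smul_le.2 fun x hx u hu => Submodule.mem_colon.1 (hle hx) u hu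

/-! ### The fibre cone and the analytic spread. -/

section FibreCone

open Polynomial

variable {R : Type*} [CommRing R] {M : Type*} [AddCommGroup M] [Module R M] {I : Ideal R}

theorem single_mem_reesModule {k : ℕ} {y : M} (hy : y ∈ I ^ k • (⊤ : Submodule R M)) :
    PolynomialModule.single R k y ∈ (I.stableFiltration (⊤ : Submodule R M)).submodule := by
  intro n
  rw [Ideal.stableFiltration_N, PolynomialModule.coeff_single, Finsupp.single_apply]
  split_ifs with h
  · exact h ▸ hy
  · exact Submodule.zero_mem _

theorem algebraMap_smul_coeff (c : R) (u : ReesModule R M I) (n : ℕ) :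
    (algebraMap R (reesAlgebra I) c • u).1.coeff n = c • u.1.coeff n := by
  have : (algebraMap R (reesAlgebra I) c • u).1 = monomial 0 c • u.1 := rfl
  rw [this, PolynomialModule.monomial_smul_apply]
  simp

variable (I M) in
/-- The submodule `⨁ₙ c Iⁿ M` of the Rees module. -/
noncomputable def reesSubmodule (c : Ideal R) : Submodule (reesAlgebra I) (ReesModule R M I) :=
  (Ideal.Filtration.submodule (I := I)
    { N := fun n => c • I ^ n • (⊤ : Submodule R M)
      mono := fun n => Submodule.smul_mono le_rfl
        (Submodule.smul_mono_left (Ideal.pow_le_pow_right n.le_succ))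
      smul_le := fun n => by
        rw [← mul_smul, mul_comm, mul_smul, ← mul_smul I, ← pow_succ'] }).comap
    (Submodule.subtype _)

theorem mem_reesSubmodule {c : Ideal R} {u : ReesModule R M I} :
    u ∈ reesSubmodule M I c ↔ ∀ n, u.1.coeff n ∈ c • I ^ n • (⊤ : Submodule R M) := Iff.rfl

theorem reesSubmodule_mono {c c' : Ideal R} (h : c ≤ c') :
    reesSubmodule M I c ≤ reesSubmodule M I c' :=
  fun _ hu n => Submodule.smul_mono_left h (hu n)

theorem map_smul_top_le_reesSubmodule (c : Ideal R) :
    c.map (algebraMap R (reesAlgebra I)) • (⊤ : Submodule (reesAlgebra I) (ReesModule R M I)) ≤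
      reesSubmodule M I c := by
  refine map_smul_top_le fun x hx u => mem_reesSubmodule.2 fun n => ?_
  rw [algebraMap_smul_coeff]
  exact Submodule.smul_mem_smul hx (u.2 n)

theorem finite_reesModule [IsNoetherianRing R] [Module.Finite R M] :
    Module.Finite (reesAlgebra I) (ReesModule R M I) := by
  have h := (Ideal.Filtration.submodule_fg_iff_stable (I.stableFiltration (⊤ : Submodule R M))
    fun _ => IsNoetherian.noetherian _).2 (I.stableFiltration_stable ⊤)
  exact Module.Finite.iff_fg.2 h

theorem finite_grModule [IsNoetherianRing R] [Module.Finite R M] :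
    Module.Finite (GrRing R I) (GrModule R M I) := by
  have := finite_reesModule (R := R) (M := M) (I := I)
  exact inferInstanceAs (Module.Finite (reesAlgebra I ⧸ reesExt R I) (ReesModule R M I ⧸
    (reesExt R I • (⊤ : Submodule (reesAlgebra I) (ReesModule R M I)))))

/-- The projection from the Rees algebra to the associated graded ring. -/
noncomputable def grMk (I : Ideal R) : reesAlgebra I →+* GrRing R I :=
  Ideal.Quotient.mk (reesExt R I)

theorem grMk_surjective : Function.Surjective (grMk I) := Ideal.Quotient.mk_surjective

variable (M I) in
/-- The projection from the Rees module to the associated graded module. -/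
noncomputable def grModuleMk : ReesModule R M I →+ GrModule R M I :=
  (Submodule.mkQ (reesExt R I • (⊤ : Submodule (reesAlgebra I) (ReesModule R M I)))).toAddMonoidHom

theorem grModuleMk_surjective : Function.Surjective (grModuleMk M I) :=
  Submodule.mkQ_surjective _

theorem grModuleMk_smul (g : reesAlgebra I) (u : ReesModule R M I) :
    grModuleMk M I (g • u) = grMk I g • grModuleMk M I u := rfl

theorem algebraMap_smul_grModuleMk (x : R) (u : ReesModule R M I) :
    algebraMap R (GrRing R I) x • grModuleMk M I u =
      grModuleMk M I (algebraMap R (reesAlgebra I) x • u) := rfl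

theorem mem_of_grModuleMk_eq_zero {u : ReesModule R M I} (h : grModuleMk M I u = 0) :
    u ∈ reesExt R I • (⊤ : Submodule (reesAlgebra I) (ReesModule R M I)) :=
  (Submodule.Quotient.mk_eq_zero _).1 h

/-- The submodule `⨁ₙ c Iⁿ M / Iⁿ⁺¹ M` of the associated graded module. -/
noncomputable def grSubmodule (M : Type*) [AddCommGroup M] [Module R M] (I c : Ideal R) :
    Submodule (GrRing R I) (GrModule R M I) where
  __ := (reesSubmodule M I c).toAddSubgroup.map (grModuleMk M I)
  smul_mem' := by
    rintro g _ ⟨w, hw, rfl⟩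
    obtain ⟨g, rfl⟩ := grMk_surjective g
    exact ⟨g • w, Submodule.smul_mem _ g hw, grModuleMk_smul g w⟩

theorem map_smul_top_le_grSubmodule (c : Ideal R) :
    c.map (algebraMap R (GrRing R I)) • (⊤ : Submodule (GrRing R I) (GrModule R M I)) ≤
      grSubmodule M I c := by
  refine map_smul_top_le fun x hx z => ?_
  obtain ⟨w, rfl⟩ := grModuleMk_surjective z
  rw [algebraMap_smul_grModuleMk]
  exact ⟨_, map_smul_top_le_reesSubmodule c
    (Submodule.smul_mem_smul (Ideal.mem_map_of_mem _ hx) trivial), rfl⟩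

theorem mem_reesSubmodule_of_grModuleMk_mem {c : Ideal R} (hIc : I ≤ c) {u : ReesModule R M I}
    (hu : grModuleMk M I u ∈
      c.map (algebraMap R (GrRing R I)) • (⊤ : Submodule (GrRing R I) (GrModule R M I))) :
    u ∈ reesSubmodule M I c := by
  obtain ⟨w, hw, hwu⟩ := map_smul_top_le_grSubmodule c hu
  have h : grModuleMk M I (u - w) = 0 := by rw [map_sub, sub_eq_zero]; exact hwu.symm
  have h' := reesSubmodule_mono hIc (map_smul_top_le_reesSubmodule I (mem_of_grModuleMk_eq_zero h))
  simpa using Submodule.add_mem _ h' hw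

variable {r : ℕ} (a : Fin r → R) (ha : Ideal.span (Set.range a) = I)

/-- The surjection from a polynomial ring to the associated graded ring of `(a₁, …, aᵣ)`. -/
noncomputable def grHom : MvPolynomial (Fin r) R →+* GrRing R I :=
  (grMk I).comp ((reesHom a : MvPolynomial (Fin r) R →+* R[X]).codRestrict (reesAlgebra I)
    fun F n => ha ▸ coeff_reesHom_mem a F n)

theorem grHom_surjective : Function.Surjective (grHom a ha) := by
  rw [grHom, RingHom.coe_comp]
  refine grMk_surjective.comp ?_
  have hle : reesAlgebra I ≤ (reesHom a).range := by
    rw [← adjoin_monomial_eq_reesAlgebra, Algebra.adjoin_le_iff]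
    rintro _ ⟨c, hc, rfl⟩
    rw [SetLike.mem_coe, ← ha, ← pow_one (Ideal.span _),
      Ideal.mem_span_pow_iff_exists_isHomogeneous] at hc
    obtain ⟨F, hF, rfl⟩ := hc
    refine ⟨F, ?_⟩
    ext n
    change (reesHom a F).coeff n = _
    rw [coeff_reesHom, MvPolynomial.homogeneousComponent_of_mem hF, coeff_monomial]
    by_cases h : n = 1
    · simp [h]
    · simp [h, Ne.symm h]
  rintro ⟨p, hp⟩
  obtain ⟨F, hF⟩ := hle hp
  exact ⟨F, Subtype.ext hF⟩

/-- Applying an annihilating element to the degree-zero elements of the Rees module puts each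
coefficient in `c Iⁿ M`; the ambiguity modulo `I` is absorbed because `I ≤ c`. This inclusion
suffices to bound the dimension of the polynomial ring modulo `gradedAnn` by that of the fibre cone.
-/
theorem comap_annihilator_le_gradedAnn {c : Ideal R} (hIc : I ≤ c)
    (hD : ∀ n, Ideal.span (Set.range a) • (c • I ^ n • (⊤ : Submodule R M)) ≤
      c • I ^ (n + 1) • ⊤) :
    (Module.annihilator (GrRing R I) (GrModule R M I ⧸ (c.map (algebraMap R (GrRing R I)) •
      (⊤ : Submodule (GrRing R I) (GrModule R M I))))).comap (grHom a ha) ≤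
      gradedAnn a (fun n => c • I ^ n • (⊤ : Submodule R M)) hD := by
  intro F hF n x
  rw [Ideal.mem_comap, Module.mem_annihilator] at hF
  obtain ⟨g, hg, hgF⟩ : ∃ g : reesAlgebra I, grMk I g = grHom a ha F ∧ g.1 = reesHom a F :=
    ⟨_, rfl, rfl⟩
  rw [← hg] at hF
  have hx : x ∈ I ^ 0 • (⊤ : Submodule R M) := by simp
  have h := (Submodule.Quotient.mk_eq_zero _).1
    (hF (Submodule.Quotient.mk (grModuleMk M I ⟨_, single_mem_reesModule hx⟩)))
  beta_reduce at h
  rw [← grModuleMk_smul] at h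
  have h' := mem_reesSubmodule.1 (mem_reesSubmodule_of_grModuleMk_mem hIc h) n
  have : (g • (⟨_, single_mem_reesModule hx⟩ : ReesModule R M I)).1 =
    g.1 • PolynomialModule.single R 0 x := rfl
  rw [this, PolynomialModule.smul_single_apply, hgF] at h'
  simpa using h'

end FibreCone

theorem length_le_of_ringKrullDim_quotient_le {S : Type*} [CommRing S] {b : Ideal S} {d : ℕ}
    (hd : ringKrullDim (S ⧸ b) ≤ d) (s : LTSeries (PrimeSpectrum S)) (hs : b ≤ s.head.asIdeal) :
    s.length ≤ d := by
  rw [ringKrullDim_quotient] at hd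
  let t : LTSeries (PrimeSpectrum.zeroLocus (b : Set S)) :=
    { length := s.length
      toFun := fun i => ⟨s i, hs.trans (s.head_le i)⟩
      step := fun i => s.step i }
  have := (Order.LTSeries.length_le_krullDim t).trans hd
  exact_mod_cast this

theorem ringKrullDim_quotient_comap {S T : Type*} [CommRing S] [CommRing T] {f : S →+* T}
    (hf : Function.Surjective f) (b : Ideal T) :
    ringKrullDim (S ⧸ b.comap f) = ringKrullDim (T ⧸ b) :=
  ringKrullDim_eq_of_ringEquiv (RingEquiv.ofBijective (Ideal.quotientMap b f le_rfl)
    ⟨Ideal.quotientMap_injective, Ideal.quotientMap_surjective hf⟩)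

/-- If the analytic spread of `I` on `M` is at most `d`, then some ideal `J` generated by `d`
elements of a power `Iᵉ` satisfies `Iⁿ⁺ᵉ M = J Iⁿ M` for some `n`. -/
theorem exists_reduction {R : Type*} [CommRing R] [IsNoetherianRing R] [IsLocalRing R]
    {M : Type*} [AddCommGroup M] [Module R M] [Module.Finite R M] {I : Ideal R}
    (hI : I ≤ IsLocalRing.maximalIdeal R) {d : ℕ} (hd : localAnalyticSpread R M I ≤ d) :
    ∃ e n₀ : ℕ, e ≠ 0 ∧ ∃ y : Fin d → R, (∀ i, y i ∈ I ^ e) ∧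
      I ^ (n₀ + e) • (⊤ : Submodule R M) ≤ Ideal.span (Set.range y) • I ^ n₀ • ⊤ := by
  obtain ⟨r, a, ha⟩ := Submodule.fg_iff_exists_fin_generating_family.1
    (IsNoetherian.noetherian I)
  have ha : Ideal.span (Set.range a) = I := ha
  have := finite_grModule (R := R) (M := M) (I := I)
  have hD : ∀ n, Ideal.span (Set.range a) • (IsLocalRing.maximalIdeal R • I ^ n •
      (⊤ : Submodule R M)) ≤ IsLocalRing.maximalIdeal R • I ^ (n + 1) • ⊤ := fun n => by
    rw [ha, ← mul_smul, mul_comm, mul_smul, ← mul_smul I, ← pow_succ']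
  refine exists_reduction_of_gradedAnn ha hD fun s hs =>
    length_le_of_ringKrullDim_quotient_le ?_ s hs
  refine (ringKrullDim_le_of_surjective _ (Ideal.Quotient.factor_surjective
    (comap_annihilator_le_gradedAnn a ha hI hD))).trans ?_
  rw [ringKrullDim_quotient_comap (grHom_surjective a ha),
    ← Module.supportDim_eq_ringKrullDim_quotient_annihilator]
  exact hd

end IrPoly

namespace IrPoly

/-! ### Finiteness of the associated primes of all `M / Iⁿ M`. -/

section AssociatedPrimes

variable {R : Type*} [CommRing R] {M : Type*} [AddCommGroup M] [Module R M]

theorem AnnihilatorMod.smul {N : Submodule R M} {p : Ideal R} [p.IsPrime] {x : M}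
    (h : AnnihilatorMod N p x) {c : R} (hc : c ∉ p) : AnnihilatorMod N p (c • x) := fun r => by
  rw [← mul_smul, ← h, Ideal.IsPrime.mul_mem_iff_mem_or_mem ‹p.IsPrime›]
  tauto

/-- Either a multiple of `x` by an element outside `p` falls into the preceding power, where its
annihilator is still `p`, or `x` already has annihilator `p` modulo that power and the exponent
drops. -/
theorem exists_annihilatorMod_pow_succ {I p : Ideal R} [hp : p.IsPrime] {n : ℕ} {x : M}
    (h : AnnihilatorMod (I ^ n • (⊤ : Submodule R M)) p x) :
    ∃ k, ∃ y ∈ I ^ k • (⊤ : Submodule R M),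
      AnnihilatorMod (I ^ (k + 1) • (⊤ : Submodule R M)) p y := by
  induction n with
  | zero =>
    exact absurd (p.eq_top_iff_one.2 ((h 1).2 (by simp))) hp.ne_top
  | succ n ih =>
    by_cases hr : ∃ r, r ∉ p ∧ r • x ∈ I ^ n • (⊤ : Submodule R M)
    · obtain ⟨r, hr, hx⟩ := hr
      exact ⟨n, r • x, hx, h.smul hr⟩
    · push Not at hr
      refine ih fun r => ⟨fun hrp => ?_, fun hrx => by_contra fun hrp => hr r hrp hrx⟩
      exact Submodule.smul_mono_left (Ideal.pow_le_pow_right n.le_succ) ((h r).1 hrp)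

/-- Among the elements whose annihilator modulo `L` contracts to `p`, take one with maximal
annihilator. If `b` does not annihilate it, its multiple by `b` belongs to the same family, and
maximality then forces primality. -/
theorem exists_associatedPrime_comap_eq {A E : Type*} [CommRing A] [IsNoetherianRing A]
    [Algebra R A] [AddCommGroup E] [Module A E] {L : Submodule A E} {p : Ideal R} [hp : p.IsPrime]
    {x : E} (hx : ∀ r, r ∈ p ↔ algebraMap R A r • x ∈ L) :
    ∃ q ∈ associatedPrimes A (E ⧸ L), q.comap (algebraMap R A) = p := by
  let ann : E → Ideal A := fun y => L.colon {y}
  have hann : ∀ y a, a ∈ ann y ↔ a • y ∈ L := fun y a => Submodule.mem_colon_singleton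
  obtain ⟨q, ⟨y, hy, rfl⟩, hmax⟩ := WellFounded.has_min (wellFounded_gt (α := Ideal A))
    {q | ∃ y, (∀ r, r ∈ p ↔ algebraMap R A r • y ∈ L) ∧ ann y = q} ⟨_, x, hx, rfl⟩
  have hle : ∀ a : A, ann y ≤ ann (a • y) := fun a b hb => by
    rw [hann, smul_comm]
    exact L.smul_mem a ((hann y b).1 hb)
  have heq : ∀ a : A, (∀ r, r ∈ p ↔ algebraMap R A r • a • y ∈ L) → ann (a • y) = ann y :=
    fun a ha => ((hle a).eq_or_lt.resolve_right fun h => hmax _ ⟨_, ha, rfl⟩ h).symm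
  have hprime : (ann y).IsPrime := by
    refine ⟨fun h => ?_, fun {a b} hab => or_iff_not_imp_right.2 fun hb => ?_⟩
    · refine hp.ne_top (p.eq_top_iff_one.2 ((hy 1).2 ?_))
      rw [map_one, ← hann, h]
      trivial
    · have hby : ∀ r, r ∈ p ↔ algebraMap R A r • b • y ∈ L := fun r => by
        refine ⟨fun hr => ?_, fun hr => by_contra fun hrp => hb ?_⟩
        · rw [smul_comm]
          exact L.smul_mem b ((hy r).1 hr)
        · rw [← heq (algebraMap R A r) fun s => ?_, hann, smul_comm]
          · exact hr
          · rw [← mul_smul, ← map_mul, ← hy, hp.mul_mem_iff_mem_or_mem]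
            tauto
      rw [← heq b hby, hann, ← mul_smul]
      exact (hann y _).1 hab
  refine ⟨ann y, mem_associatedPrimes_quotient.2 ⟨hprime, y, fun a => hann y a⟩, ?_⟩
  ext r
  rw [Ideal.mem_comap, hann, hy]

/-- The primes associated to some `M / Iⁿ M` form a finite set. -/
theorem exists_finset_associatedPrimes [IsNoetherianRing R] [Module.Finite R M] (I : Ideal R) :
    ∃ F : Finset (PrimeSpectrum R), ∀ p : PrimeSpectrum R, ∀ n : ℕ,
      p.asIdeal ∈ associatedPrimes R (M ⧸ (I ^ n • (⊤ : Submodule R M))) → p ∈ F := by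
  have := finite_reesModule (R := R) (M := M) (I := I)
  have hfin := ((associatedPrimes.finite (reesAlgebra I)
    (ReesModule R M I ⧸ reesSubmodule M I I)).image
      (Ideal.comap (algebraMap R (reesAlgebra I)))).preimage
    (f := PrimeSpectrum.asIdeal) fun _ _ _ _ h => PrimeSpectrum.ext h
  refine ⟨hfin.toFinset, fun p n hp => ?_⟩
  rw [Set.Finite.mem_toFinset]
  obtain ⟨_, x, hx⟩ := mem_associatedPrimes_quotient.1 hp
  obtain ⟨k, y, hyk, hy⟩ := exists_annihilatorMod_pow_succ hx
  -- Placing `y` in degree `k` gives an element of the quotient `⨁ Iⁿ M / Iⁿ⁺¹ M`, finite over the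
  -- Noetherian Rees algebra, whose annihilator contracts to `p`.
  refine exists_associatedPrime_comap_eq (x := (⟨_, single_mem_reesModule hyk⟩ :
    ReesModule R M I)) fun r => ?_
  rw [hy, mem_reesSubmodule]
  simp only [algebraMap_smul_coeff, PolynomialModule.coeff_single, Finsupp.single_apply]
  rw [pow_succ', mul_smul]
  refine ⟨fun h n => ?_, fun h => by simpa using h k⟩
  split_ifs with hn
  · exact hn ▸ h
  · simp

end AssociatedPrimes
end IrPoly

namespace IrPoly

open Polynomial Filter

/-! ### Passage to localizations and the degree of the polynomial. -/

section Localization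

variable {R : Type*} [CommRing R] {M : Type*} [AddCommGroup M] [Module R M]

theorem localized_smul (S : Submonoid R) (J : Ideal R) (N : Submodule R M) :
    (J • N).localized S = J.map (algebraMap R (Localization S)) • N.localized S := by
  rw [← Ideal.localized'_eq_map (Localization S) S]
  exact Submodule.localized'_smul ..

theorem localized_smul_top (S : Submonoid R) (J : Ideal R) :
    (J • (⊤ : Submodule R M)).localized S = J.map (algebraMap R (Localization S)) • ⊤ := by
  have h : (⊤ : Submodule R M).localized S = ⊤ := Submodule.localized'_top ..
  rw [localized_smul, h]

theorem localized_pow_smul_top (S : Submonoid R) (I : Ideal R) (n : ℕ) :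
    (I ^ n • (⊤ : Submodule R M)).localized S =
      I.map (algebraMap R (Localization S)) ^ n • ⊤ := by
  rw [localized_smul_top, Ideal.map_pow]

theorem localized_le_localized {S : Submonoid R} {P Q : Submodule R M} {s : R} (hs : s ∈ S)
    (h : ∀ x ∈ P, s • x ∈ Q) : P.localized S ≤ Q.localized S := by
  refine (Submodule.localized'_eq_span ..).trans_le (Submodule.span_le.2 ?_)
  rintro _ ⟨x, hx, rfl⟩
  exact mkLinearMap_mem_localized.2 ⟨⟨s, hs⟩, h x hx⟩

theorem exists_smul_mem_of_localized_le {S : Submonoid R} {P Q : Submodule R M} (hP : P.FG)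
    (h : P.localized S ≤ Q.localized S) : ∃ s ∈ S, ∀ x ∈ P, s • x ∈ Q := by
  have h' : ∀ x ∈ P, ∃ s ∈ S, s • x ∈ Q := fun x hx => by
    obtain ⟨s, hs⟩ := mkLinearMap_mem_localized.1
      (h (mkLinearMap_mem_localized.2 ⟨1, by simpa using hx⟩))
    exact ⟨s, s.2, hs⟩
  clear h
  induction P, hP using Submodule.fg_induction with
  | singleton x =>
    obtain ⟨s, hs, hsx⟩ := h' x (Submodule.mem_span_singleton_self x)
    refine ⟨s, hs, fun y hy => ?_⟩
    obtain ⟨c, rfl⟩ := Submodule.mem_span_singleton.1 hy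
    rw [smul_comm]
    exact Q.smul_mem c hsx
  | sup P₁ P₂ _ _ ih₁ ih₂ =>
    obtain ⟨s, hs, h₁⟩ := ih₁ fun x hx => h' x (Submodule.mem_sup_left hx)
    obtain ⟨t, ht, h₂⟩ := ih₂ fun x hx => h' x (Submodule.mem_sup_right hx)
    refine ⟨s * t, S.mul_mem hs ht, fun x hx => ?_⟩
    obtain ⟨y, hy, z, hz, rfl⟩ := Submodule.mem_sup.1 hx
    rw [smul_add]
    refine Q.add_mem ?_ ?_
    · rw [mul_comm, mul_smul]
      exact Q.smul_mem t (h₁ y hy)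
    · rw [mul_smul]
      exact Q.smul_mem s (h₂ z hz)

theorem map_le_maximalIdeal {I p : Ideal R} [p.IsPrime] (h : I ≤ p) :
    I.map (algebraMap R (Localization.AtPrime p)) ≤
      IsLocalRing.maximalIdeal (Localization.AtPrime p) := by
  rw [← Localization.AtPrime.map_eq_maximalIdeal]
  exact Ideal.map_mono h

theorem primeSocleLen_pow_smul_top (p : PrimeSpectrum R) (I : Ideal R) (n : ℕ) :
    primeSocleLen p (I ^ n • (⊤ : Submodule R M)) =
      socleLen (I.map (algebraMap R (Localization.AtPrime p.asIdeal)) ^ n •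
        (⊤ : Submodule (Localization.AtPrime p.asIdeal)
          (LocalizedModule p.asIdeal.primeCompl M))) := by
  rw [primeSocleLen, localized_pow_smul_top]

theorem le_of_mem_associatedPrimes [IsNoetherianRing R] {I p : Ideal R} {n : ℕ}
    (hp : p ∈ associatedPrimes R (M ⧸ (I ^ n • (⊤ : Submodule R M)))) : I ≤ p := by
  obtain ⟨hp, x, hx⟩ := mem_associatedPrimes_quotient.1 hp
  exact Ideal.IsPrime.le_of_pow_le (n := n)
    fun c hc => (hx c).2 (Submodule.smul_mem_smul hc trivial)

variable [IsNoetherianRing R] [Module.Finite R M]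

theorem exists_primeSoclePolynomial (I : Ideal R) (p : PrimeSpectrum R) :
    ∃ P : ℚ[X], ∀ᶠ n : ℕ in atTop,
      ((primeSocleLen p (I ^ n • (⊤ : Submodule R M))).toNat : ℚ) = P.eval (n : ℚ) := by
  by_cases hI : I ≤ p.asIdeal
  · simp_rw [primeSocleLen_pow_smul_top]
    exact exists_soclePolynomial (map_le_maximalIdeal hI)
  · refine ⟨0, Eventually.of_forall fun n => ?_⟩
    have : primeSocleLen p (I ^ n • (⊤ : Submodule R M)) = 0 := by
      by_contra h
      exact hI (le_of_mem_associatedPrimes (mem_associatedPrimes_of_primeSocleLen_ne_zero p h))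
    simp [this]

/-- A reduction of a power of `I R_𝔪` with `d` generators comes, up to a denominator, from
elements of that power of `I`. -/
theorem exists_reduction_of_localization {I m : Ideal R} [m.IsPrime] (hI : I ≤ m) {d : ℕ}
    (hd : localAnalyticSpread (Localization.AtPrime m) (LocalizedModule.AtPrime m M)
      (I.map (algebraMap R (Localization.AtPrime m))) ≤ d) :
    ∃ e n₀ : ℕ, e ≠ 0 ∧ ∃ y : Fin d → R, (∀ i, y i ∈ I ^ e) ∧ ∃ f ∉ m,
      ∀ x ∈ I ^ (n₀ + e) • (⊤ : Submodule R M),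
        f • x ∈ Ideal.span (Set.range y) • I ^ n₀ • (⊤ : Submodule R M) := by
  obtain ⟨e, n₀, he, y', hy', hred⟩ := exists_reduction (map_le_maximalIdeal hI) hd
  have h : ∀ i, ∃ y ∈ I ^ e, ∃ t : m.primeCompl,
      y' i * algebraMap R (Localization.AtPrime m) t = algebraMap R _ y := fun i => by
    have := hy' i
    rw [← Ideal.map_pow, IsLocalization.mem_map_algebraMap_iff m.primeCompl] at this
    obtain ⟨⟨y, t⟩, h⟩ := this
    exact ⟨y, y.2, t, h⟩
  choose y hy t ht using h
  refine ⟨e, n₀, he, y, hy, exists_smul_mem_of_localized_le (S := m.primeCompl)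
    (IsNoetherian.noetherian _) ?_⟩
  rw [localized_pow_smul_top, localized_smul, localized_pow_smul_top]
  refine hred.trans (Submodule.smul_mono_left ?_)
  rw [Ideal.span_le]
  rintro _ ⟨i, rfl⟩
  have hu := IsLocalization.map_units (Localization.AtPrime m) (t i)
  rw [SetLike.mem_coe, ← Ideal.mul_unit_mem_iff_mem _ hu, ht]
  exact Ideal.mem_map_of_mem _ (Ideal.subset_span ⟨i, rfl⟩)

theorem degree_primeSoclePolynomial_lt_of_reduction {I : Ideal R} {p : PrimeSpectrum R}
    (hI : I ≤ p.asIdeal) {P : ℚ[X]} (hP : ∀ᶠ n : ℕ in atTop,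
      ((primeSocleLen p (I ^ n • (⊤ : Submodule R M))).toNat : ℚ) = P.eval (n : ℚ))
    {d e n₀ : ℕ} (hd : d ≠ 0) (he : e ≠ 0) {y : Fin d → R} (hy : ∀ i, y i ∈ I ^ e) {f : R}
    (hf : f ∉ p.asIdeal) (hred : ∀ x ∈ I ^ (n₀ + e) • (⊤ : Submodule R M),
        f • x ∈ Ideal.span (Set.range y) • I ^ n₀ • (⊤ : Submodule R M)) :
    P.degree < d := by
  simp_rw [primeSocleLen_pow_smul_top] at hP
  refine degree_soclePolynomial_lt (map_le_maximalIdeal hI) hP hd he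
    (fun i => algebraMap R _ (y i)) (n₀ := n₀) (fun i => ?_) ?_
  · rw [← Ideal.map_pow]
    exact Ideal.mem_map_of_mem _ (hy i)
  · have h := localized_le_localized (S := p.asIdeal.primeCompl) hf hred
    rw [localized_pow_smul_top, localized_smul, localized_pow_smul_top, Ideal.map_span,
      ← Set.range_comp] at h
    exact h

/-- The analytic spread is only controlled at maximal ideals, so the reduction is found there and
then localized to the smaller prime `p`. Since `p` is a stable associated prime, the chosen maximal
ideal is one of those over which the supremum is taken. -/
theorem degree_primeSoclePolynomial_lt {I : Ideal R} {d : ℕ} (hd : d ≠ 0)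
    (h : analyticSpread R M I ≤ d) {p : PrimeSpectrum R} (hp : p.asIdeal ∈ stableAss R M I)
    {P : ℚ[X]} (hP : ∀ᶠ n : ℕ in atTop,
      ((primeSocleLen p (I ^ n • (⊤ : Submodule R M))).toNat : ℚ) = P.eval (n : ℚ)) :
    P.degree < d := by
  obtain ⟨n, hn⟩ := Filter.Eventually.exists hp
  have hI : I ≤ p.asIdeal := le_of_mem_associatedPrimes hn
  rw [analyticSpread] at h
  split_ifs at h with hR
  · obtain ⟨e, n₀, he, y, hy, hred⟩ :=
      exists_reduction (hI.trans (IsLocalRing.le_maximalIdeal p.2.ne_top)) h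
    exact degree_primeSoclePolynomial_lt_of_reduction hI hP hd he hy
      (p.asIdeal.ne_top_iff_one.1 p.2.ne_top) fun x hx => by simpa using hred hx
  · obtain ⟨m, hm, hpm⟩ := p.asIdeal.exists_le_maximal p.2.ne_top
    have hspread := (le_iSup (fun m : {m : MaximalSpectrum R //
      ∃ p ∈ stableAss R M I, p ≤ m.asIdeal} => localAnalyticSpread
        (Localization.AtPrime m.1.asIdeal) (LocalizedModule.AtPrime m.1.asIdeal M)
        (I.map (algebraMap R (Localization.AtPrime m.1.asIdeal)))) ⟨⟨m, hm⟩, _, hp, hpm⟩).trans h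
    have := hm.isPrime
    obtain ⟨e, n₀, he, y, hy, f, hf, hred⟩ :=
      exists_reduction_of_localization (hI.trans hpm) hspread
    exact degree_primeSoclePolynomial_lt_of_reduction hI hP hd he hy
      (fun h => hf (hpm h)) hred

theorem supportDim_le_of_polyBounded_primeSocleLen {I : Ideal R} {p : PrimeSpectrum R}
    (hp : Minimal (fun q : Ideal R => q ∈ associatedPrimes R (M ⧸ (I • (⊤ : Submodule R M))))
      p.asIdeal) {d : ℕ}
    (h : PolyBounded d fun n => primeSocleLen p (I ^ n • (⊤ : Submodule R M))) :
    Module.supportDim (Localization.AtPrime p.asIdeal)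
      (LocalizedModule.AtPrime p.asIdeal M) ≤ d := by
  have hI : I ≤ p.asIdeal := le_of_mem_associatedPrimes (M := M) (n := 1)
    ((pow_one I).symm ▸ hp.prop)
  set A := Module.annihilator R (M ⧸ (I • (⊤ : Submodule R M))) with hA
  have hAtop : A • (⊤ : Submodule R M) ≤ I • ⊤ := Submodule.smul_le.2 fun c hc x _ =>
    (Submodule.Quotient.mk_eq_zero _).1 (Module.mem_annihilator.1 hc (Submodule.Quotient.mk x))
  have hAp : A ≤ p.asIdeal := by
    obtain ⟨_, x, hx⟩ := mem_associatedPrimes_quotient.1 hp.prop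
    exact fun c hc => (hx c).2 (hAtop (Submodule.smul_mem_smul hc trivial))
  -- Minimal primes of the annihilator of `M / I M` are associated, so `p` is one of them. Hence a
  -- power of the maximal ideal of `R_p` lies in the localized annihilator and carries `M_p` into `I
  -- M_p`.
  have hmin : p.asIdeal ∈ A.minimalPrimes := by
    obtain ⟨q, hq, hqp⟩ := Ideal.exists_minimalPrimes_le hAp
    have := hp.le_of_le
      (Module.associatedPrimes.minimalPrimes_annihilator_subset_associatedPrimes R _ hq) hqp
    rwa [← hqp.antisymm this]
  obtain ⟨s, hs⟩ := Ideal.exists_pow_le_of_le_radical_of_fg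
    (IsLocalization.AtPrime.radical_map_of_mem_minimalPrimes (Localization.AtPrime p.asIdeal)
      p.asIdeal A hmin).ge (IsNoetherian.noetherian _)
  rw [Localization.AtPrime.map_eq_maximalIdeal] at hs
  simp_rw [primeSocleLen_pow_smul_top] at h
  refine supportDim_le_of_polyBounded_socleLen (map_le_maximalIdeal hI) (s := s) ?_ h
  refine (Submodule.smul_mono_left hs).trans ?_
  have := localized_le_localized (S := p.asIdeal.primeCompl) (one_mem _)
    fun x hx => by simpa using hAtop hx
  rwa [localized_smul_top, localized_smul_top] at this

/-- The degree of `Ir_{M,I}` when `ℓ_M(I)` is attained by the dimension of `M` at a minimal member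
of `Ass (M / I M)`. -/
theorem exists_isIrPolynomial_of_le_supportDim {I : Ideal R} {d : ℕ} (hd : d ≠ 0)
    (hspread : analyticSpread R M I ≤ d) {p : PrimeSpectrum R}
    (hp : Minimal (fun q : Ideal R => q ∈ associatedPrimes R (M ⧸ (I • (⊤ : Submodule R M))))
      p.asIdeal)
    (hdim : d ≤ Module.supportDim (Localization.AtPrime p.asIdeal)
      (LocalizedModule.AtPrime p.asIdeal M)) :
    ∃ P : ℚ[X], IsIrPolynomial R M I P ∧ P ≠ 0 ∧ P.natDegree + 1 = d := by
  obtain ⟨F, hF⟩ := exists_finset_associatedPrimes (M := M) I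
  choose P hP using fun q => exists_primeSoclePolynomial (M := M) I q
  have hIr : ∀ᶠ n : ℕ in atTop, (∑ q ∈ F, P q).eval (n : ℚ) =
      ∑ q ∈ F, ((primeSocleLen q (I ^ n • (⊤ : Submodule R M))).toNat : ℚ) := by
    filter_upwards [(eventually_all_finset F).2 fun q _ => hP q] with n hn
    rw [eval_finsetSum]
    exact Finset.sum_congr rfl fun q hq => (hn q hq).symm
  have hpoly : IsIrPolynomial R M I (∑ q ∈ F, P q) := by
    rw [IsIrPolynomial]
    filter_upwards [hIr] with n hn
    rw [hn, ir_eq_sum _ F fun q hq => hF q n hq]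
    push_cast
    rfl
  have hdeg : ∀ q, (P q).degree < d := fun q => by
    by_cases h0 : P q = 0
    · rw [h0, degree_zero]
      exact WithBot.bot_lt_coe d
    · refine degree_primeSoclePolynomial_lt hd hspread ?_ (hP q)
      -- A nonzero polynomial has finitely many roots, so the socle at `q` is eventually nonzero and
      -- `q` is a stable associated prime.
      have hroots : ∀ᶠ n : ℕ in atTop, (P q).eval (n : ℚ) ≠ 0 := by
        rw [← Nat.cofinite_eq_atTop, eventually_cofinite]
        simp only [not_not]
        exact (finite_setOfPred_isRoot h0).preimage Nat.cast_injective.injOn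
      filter_upwards [hroots, hP q] with n hn hn'
      refine mem_associatedPrimes_of_primeSocleLen_ne_zero q fun h => hn ?_
      rw [← hn', h]
      rfl
  have hlt : (∑ q ∈ F, P q).degree < d :=
    mem_degreeLT.1 (Submodule.sum_mem _ fun q _ => mem_degreeLT.2 (hdeg q))
  -- The summand at `p` is at most the whole sum, all terms being nonnegative. A total degree below
  -- `d - 1` would force `dim M_p ≤ d - 1`, impossible since `d ≠ 0`.
  have hge : ¬ (∑ q ∈ F, P q).degree < (d - 1 : ℕ) := fun h => by
    have := hdim.trans (supportDim_le_of_polyBounded_primeSocleLen hp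
      (PolyBounded.of_eq (Eventually.of_forall fun n => socleLen_ne_top _) h ?_))
    · have : d ≤ d - 1 := by exact_mod_cast this
      lia
    · filter_upwards [hIr] with n hn
      rw [hn]
      refine Finset.single_le_sum (f := fun q =>
        ((primeSocleLen q (I ^ n • (⊤ : Submodule R M))).toNat : ℚ))
        (fun _ _ => Nat.cast_nonneg _) (hF p 1 ((pow_one I).symm ▸ hp.prop))
  have h0 : ∑ q ∈ F, P q ≠ 0 := fun h => hge (by
    rw [h, degree_zero]
    exact WithBot.bot_lt_coe _)
  refine ⟨_, hpoly, h0, ?_⟩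
  rw [degree_eq_natDegree h0] at hlt hge
  have h₁ : (∑ q ∈ F, P q).natDegree < d := by exact_mod_cast hlt
  have h₂ : ¬ (∑ q ∈ F, P q).natDegree < d - 1 := by exact_mod_cast hge
  lia

end Localization
end IrPoly

namespace IrPoly

/-! ### The two forms of the result. -/

section Conclusion

variable {R : Type*} [CommRing R]

theorem localAnalyticSpread_top [IsLocalRing R] {M : Type*} [AddCommGroup M] [Module R M] :
    localAnalyticSpread R M ⊤ = ⊥ := by
  have h : Subsingleton (GrRing R ⊤) :=
    Ideal.Quotient.subsingleton_iff.2 (Ideal.map_top (algebraMap R (reesAlgebra ⊤)))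
  have := Module.subsingleton (GrRing R ⊤) (GrModule R M ⊤ ⧸
    ((IsLocalRing.maximalIdeal R).map (algebraMap R (GrRing R ⊤)) •
      (⊤ : Submodule (GrRing R ⊤) (GrModule R M ⊤))))
  exact Module.supportDim_eq_bot_of_subsingleton _ _

theorem exists_natCast_eq {x : WithBot ℕ∞} (h₁ : 1 ≤ x) (h : x ≠ ⊤) : ∃ d : ℕ, d ≠ 0 ∧ x = d := by
  obtain ⟨y, rfl⟩ := WithBot.ne_bot_iff_exists.1 (ne_bot_of_le_ne_bot (by decide) h₁)
  obtain ⟨d, rfl⟩ := ENat.ne_top_iff_exists.1 (fun hy => h (by rw [hy]; rfl) : y ≠ ⊤)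
  refine ⟨d, ?_, rfl⟩
  rintro rfl
  exact absurd h₁ (by decide)

theorem exists_isIrPolynomial_of_analyticSpread_eq_bight [IsNoetherianRing R] {M : Type*}
    [AddCommGroup M] [Module R M] [Module.Finite R M] {I : Ideal R}
    (h₁ : 1 ≤ analyticSpread R M I) (h : analyticSpread R M I = bight R M I) :
    ∃ P : Polynomial ℚ, IsIrPolynomial R M I P ∧ P ≠ 0 ∧
      (P.natDegree : WithBot ℕ∞) + 1 = analyticSpread R M I := by
  let ι := {p : PrimeSpectrum R //
    Minimal (fun q : Ideal R => q ∈ associatedPrimes R (M ⧸ (I • (⊤ : Submodule R M)))) p.asIdeal}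
  have : Finite ι := ((associatedPrimes.finite R (M ⧸ (I • (⊤ : Submodule R M)))).preimage
    (f := PrimeSpectrum.asIdeal) fun _ _ _ _ h => PrimeSpectrum.ext h).subset fun p hp => hp.1
  have : Nonempty ι := by
    by_contra hι
    rw [not_nonempty_iff] at hι
    rw [h, bight, iSup_of_empty] at h₁
    exact absurd h₁ (by decide)
  -- The big height is a supremum over a finite nonempty set, hence attained; its value is finite
  -- because Noetherian local rings have finite dimension.
  obtain ⟨p, hp⟩ := exists_eq_ciSup_of_finite (f := fun p : ι =>
    Module.supportDim (Localization.AtPrime p.1.asIdeal) (LocalizedModule.AtPrime p.1.asIdeal M))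
  have hbight := h.trans hp.symm
  obtain ⟨d, hd, hd'⟩ := exists_natCast_eq h₁ (by
    rw [hbight]
    exact ((Module.supportDim_le_ringKrullDim _ _).trans_lt ringKrullDim_lt_top).ne)
  obtain ⟨P, hP, h0, hdeg⟩ := exists_isIrPolynomial_of_le_supportDim hd hd'.le p.2
    (hd'.symm.trans hbight).le
  refine ⟨P, hP, h0, ?_⟩
  rw [hd', ← hdeg]
  push_cast
  rfl

theorem supportDim_localization_self (p : PrimeSpectrum R) :
    Module.supportDim (Localization.AtPrime p.asIdeal) (LocalizedModule.AtPrime p.asIdeal R) =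
      p.asIdeal.height := by
  rw [← IsLocalization.AtPrime.ringKrullDim_eq_height p.asIdeal (Localization.AtPrime p.asIdeal),
    ← Module.supportDim_self_eq_ringKrullDim]

theorem minimal_associatedPrimes_of_mem_minimalPrimes [IsNoetherianRing R] {I p : Ideal R}
    (hp : p ∈ I.minimalPrimes) :
    Minimal (fun q : Ideal R => q ∈ associatedPrimes R (R ⧸ (I • (⊤ : Submodule R R)))) p := by
  have hI : (I • (⊤ : Submodule R R)) = I := by rw [smul_eq_mul, Ideal.mul_top]
  refine ⟨?_, fun q hq hqp => hp.2 ⟨hq.isPrime, ?_⟩ hqp⟩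
  · refine Module.associatedPrimes.minimalPrimes_annihilator_subset_associatedPrimes R _ ?_
    rwa [hI, Ideal.annihilator_quotient]
  · exact le_of_mem_associatedPrimes (M := R) (n := 1) ((pow_one I).symm ▸ hq)

/-- Any minimal prime `p` of `I` serves: only `ht p ≥ ht I` is needed, and the attainment of the big
height plays no role. The unit ideal is excluded because its analytic spread is `⊥`. -/
theorem exists_isIrPolynomial_of_isEquimultiple [IsNoetherianRing R] [IsLocalRing R] {I : Ideal R}
    (h₁ : 1 ≤ I.height) (h : IsEquimultiple R I) :
    ∃ P : Polynomial ℚ, IsIrPolynomial R R I P ∧ P ≠ 0 ∧ (P.natDegree : ℕ∞) + 1 = I.height := by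
  have hI : I ≠ ⊤ := by
    rintro rfl
    rw [IsEquimultiple, analyticSpread, dif_pos ‹_›, localAnalyticSpread_top] at h
    exact WithBot.bot_ne_coe h
  obtain ⟨d, hd⟩ := ENat.ne_top_iff_exists.1 (Ideal.height_ne_top hI)
  rw [IsEquimultiple] at h
  rw [← hd] at h₁ h ⊢
  have hd0 : d ≠ 0 := by
    rintro rfl
    exact absurd h₁ (by decide)
  obtain ⟨p, hp⟩ := Ideal.nonempty_minimalPrimes hI
  have hprime := hp.isPrime
  obtain ⟨P, hP, h0, hdeg⟩ := exists_isIrPolynomial_of_le_supportDim hd0 h.le (p := ⟨p, hprime⟩)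
    (minimal_associatedPrimes_of_mem_minimalPrimes hp) (by
      rw [supportDim_localization_self]
      change ((d : ℕ∞) : WithBot ℕ∞) ≤ _
      rw [hd]
      exact WithBot.coe_le_coe.2 (Ideal.height_mono hp.le))
  refine ⟨P, hP, h0, ?_⟩
  exact_mod_cast hdeg

end Conclusion
end IrPoly

theorem corollary4p3 :
    (∀ (R : Type u) [CommRing R] [IsNoetherianRing R]
        (M : Type v) [AddCommGroup M] [Module R M] [Module.Finite R M] (I : Ideal R),
        1 ≤ IrPoly.analyticSpread R M I →
        IrPoly.analyticSpread R M I = IrPoly.bight R M I →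
        ∃ P : Polynomial ℚ, IrPoly.IsIrPolynomial R M I P ∧ P ≠ 0 ∧
          (P.natDegree : WithBot ℕ∞) + 1 = IrPoly.analyticSpread R M I) ∧
    (∀ (R : Type u) [CommRing R] [IsNoetherianRing R] [IsLocalRing R] (I : Ideal R),
        1 ≤ I.height →
        IrPoly.IsEquimultiple R I →
        ∃ P : Polynomial ℚ, IrPoly.IsIrPolynomial R R I P ∧ P ≠ 0 ∧
          (P.natDegree : ℕ∞) + 1 = I.height) :=
  ⟨fun _ _ _ _ _ _ _ _ h₁ h => IrPoly.exists_isIrPolynomial_of_analyticSpread_eq_bight h₁ h,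
    fun _ _ _ _ _ h₁ h => IrPoly.exists_isIrPolynomial_of_isEquimultiple h₁ h⟩
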